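/- Let $k$ be a field, let $X$ be a well-ordered set, and let $\Omega=\bigcup_{m\ge 1}\Omega_m$ be a well-ordered set of operator symbols, where the elements of $\Omega_m$ are $m$-ary. A Lie $\Omega$-algebra is a Lie algebra over $k$ in which each $\omega\in\Omega_m$ acts as an $m$-ary $k$-multilinear operation; homomorphisms and subalgebras are required to respect these operations. A Lie $\Omega$-algebra $F$ with an injective map $\iota:X\to F$ is free on $X$ if for every Lie $\Omega$-algebra $A$ and every map $\sigma:X\to A$ there is a unique Lie $\Omega$-algebra homomorphism $f:F\to A$ with $f\iota=\sigma$. Let $\langle\Omega;X\rangle$ be the set of associative $\Omega$-words, i.e. the smallest set of nonempty words $u_1u_2\cdots u_n$ in prime factors, where a prime is either a letter $x\in X$ or an expression $\omega(v_1,\dots,v_m)$ with $\omega\in\Omega_m$ and $v_i\in\langle\Omega;X\rangle$. Non-associative $\Omega$-words are defined in the same way with nonempty non-associative (bracketed) words in place of associative words. Let $k\langle\Omega;X\rangle$ be the (non-unital) associative $k$-algebra with basis $\langle\Omega;X\rangle$ and multiplication given by concatenation, with each $\omega$ acting as the multilinear extension of $(v_1,\dots,v_m)\mapsto\omega(v_1,\dots,v_m)$.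 It is a Lie $\Omega$-algebra under $(uv)=uv-vu$. Let $\mathrm{Lie}(\Omega;X)$ be its Lie $\Omega$-subalgebra generated by $X$. Every non-associative $\Omega$-word is evaluated in $\mathrm{Lie}(\Omega;X)$ by reading brackets as Lie brackets and operator symbols as operators. Order $\langle\Omega;X\rangle$ by comparing $(\deg u,n,u_1,\dots,u_n)$ lexicographically for $u=u_1\cdots u_n$ with all $u_i$ prime. Here $\deg u$ is the number of occurrences of elements of $X$ and $\Omega$ in $u$. Primes are compared first by degree; two letters are compared by the order of $X$; and $\omega(v_1,\dots,v_m)$, $\theta(w_1,\dots,w_l)$ of the same degree are compared by comparing $(\omega,v_1,\dots,v_m)$ and $(\theta,w_1,\dots,w_l)$ lexicographically. Let $\succ$ be the resulting order on primes; bracketed primes are ordered by $\succ$ after erasing all brackets. For an ordered alphabet $(Y,\succ)$ let $\succ_{lex}$ be the lexicographic order on words in which a proper prefix of a word is larger than the word. A nonempty associative word $w$ is an associative Lyndon–Shirshov word if $uv\succ_{lex}vu$ whenever $w=uv$ with $u,v$ nonempty. A non-associative word $(u)$ is a non-associative Lyndon–Shirshov word if (a) the associative word $u$ obtained by erasing the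 brackets between letters of $Y$ is an associative Lyndon–Shirshov word; (b) if $(u)=((v)(w))$, then $(v)$ and $(w)$ are non-associative Lyndon–Shirshov words; (c) if moreover $(v)=((v_1)(v_2))$, then $v_2\preceq_{lex}w$. Let $NLSW(Y)$ be the set of these words. Put $NLSW(\Omega;X)_0=NLSW(X)$, let $NLSW(\Omega;X)_n=NLSW(Y_n)$ for $n\geq 1$, where the alphabet $Y_n$ consists of the letters $x\in X$ and all $\omega(t_1,\dots,t_m)$ with $\omega\in\Omega_m$ and $t_i\in NLSW(\Omega;X)_{n-1}$, ordered by $\succ$, and put $NLSW(\Omega;X)=\bigcup_{n\ge 0}NLSW(\Omega;X)_n$. **Theorem.** $\mathrm{Lie}(\Omega;X)$, with the inclusion of $X$, is a free Lie $\Omega$-algebra on the set $X$, and the elements of $NLSW(\Omega;X)$, evaluated in $\mathrm{Lie}(\Omega;X)$, form a linear basis of it over $k$ (distinct words having distinct values). -/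

import Mathlib

universe w

/-! ## Lyndon–Shirshov words on an alphabet `α` with strict order `lt` -/

namespace LyndonShirshov

variable {α : Type*}

/-- The list of letters of a nonempty associative word. -/
def letters (w : FreeSemigroup α) : List α := w.head :: w.tail

/-- The strict lexicographic order `u <_lex v` on associative words (the empty word included) in
which the empty word is larger than every nonempty word, so that a proper prefix is larger. -/
inductive LexLT (lt : α → α → Prop) : List α → List α → Prop
  | nil (a : α) (u : List α) : LexLT lt (a :: u) []
  | head {a b : α} (h : lt a b) (u v : List α) : LexLT lt (a :: u) (b :: v)
  | tail (a : α) {u v : List α} (h : LexLT lt u v) : LexLT lt (a :: u) (a :: v)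

/-- `w` is an associative Lyndon–Shirshov word: `u v >_lex v u` for every decomposition `w = u v`
into nonempty words `u`, `v`. -/
def IsALSW (lt : α → α → Prop) (w : FreeSemigroup α) : Prop :=
  ∀ u v : FreeSemigroup α, w = u * v → LexLT lt (letters (v * u)) (letters (u * v))

/-- The condition on a non-associative word `(v)(w)` with `(v) = ((v₁)(v₂))`: `v₂ ≤_lex w`.
There is no condition if `(v)` is a single letter. -/
def RightFactorLE (lt : α → α → Prop) : FreeMagma α → FreeMagma α → Prop
  | .of _, _ => True
  | .mul _ v₂, w =>
      v₂.toFreeSemigroup = w.toFreeSemigroup ∨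
        LexLT lt (letters v₂.toFreeSemigroup) (letters w.toFreeSemigroup)

/-- `(u)` is a non-associative Lyndon–Shirshov word: the underlying associative word `u` is an
associative Lyndon–Shirshov word, and if `(u) = ((v)(w))`, then `(v)` and `(w)` are
non-associative Lyndon–Shirshov words such that `v₂ ≤_lex w` whenever `(v) = ((v₁)(v₂))`. -/
def IsNLSW (lt : α → α → Prop) : FreeMagma α → Prop
  | .of a => IsALSW lt (FreeSemigroup.of a)
  | .mul v w =>
      IsALSW lt (v.toFreeSemigroup * w.toFreeSemigroup) ∧ IsNLSW lt v ∧ IsNLSW lt w ∧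
        RightFactorLE lt v w

/-- The set `NLSW(Y)` of non-associative Lyndon–Shirshov words all of whose letters lie in the
set `Y`. -/
def NLSW (lt : α → α → Prop) (Y : Set α) : Set (FreeMagma α) :=
  {t | (∀ a ∈ letters t.toFreeSemigroup, a ∈ Y) ∧ IsNLSW lt t}

end LyndonShirshov

/-! ## Associative `Ω`-words

A set of operators is a type `Ω` with an arity function `ar : Ω → ℕ`. -/

/-- The prime associative `Ω`-words on `X`: the letters `x ∈ X` and the words `ω(u₁, …, uₘ)` with
`ω` of arity `m` and nonempty associative words `uᵢ` in prime `Ω`-words. -/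
inductive OmegaPrime {Ω : Type*} (ar : Ω → ℕ) (X : Type*)
  | letter (x : X) : OmegaPrime ar X
  | op (ω : Ω) (u : Fin (ar ω) → FreeSemigroup (OmegaPrime ar X)) : OmegaPrime ar X

/-- The set `⟨Ω; X⟩` of associative `Ω`-words on `X`: nonempty words in prime `Ω`-words. -/
abbrev OmegaWord {Ω : Type*} (ar : Ω → ℕ) (X : Type*) := FreeSemigroup (OmegaPrime ar X)

section Order

variable {Ω X : Type*} {ar : Ω → ℕ}

/-! The degree: the number of occurrences of all `x ∈ X` and all `ω ∈ Ω`. -/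

mutual

/-- The degree of a prime `Ω`-word. -/
def OmegaPrime.deg : OmegaPrime ar X → ℕ
  | .letter _ => 1
  | .op _ u => 1 + ∑ i, OmegaWord.deg (u i)

/-- The degree of an `Ω`-word. -/
def OmegaWord.deg : FreeSemigroup (OmegaPrime ar X) → ℕ
  | ⟨p, l⟩ => OmegaPrime.deg p + OmegaWord.degList l

/-- The degree of a list of prime `Ω`-words. -/
def OmegaWord.degList : List (OmegaPrime ar X) → ℕ
  | [] => 0
  | p :: l => OmegaPrime.deg p + OmegaWord.degList l

end

variable [LT X] [LT Ω]

/-! The deg-lex order `<_Dl` on `Ω`-words, and its restriction `≺` to prime `Ω`-words. -/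

mutual

/-- The order `p ≺ q` on prime `Ω`-words: first compare the degrees; two letters are compared in
`X`; if `ω(u₁, …, uₘ)` and `θ(v₁, …, vₙ)` have the same degree, then `(ω, u₁, …, uₘ)` and
`(θ, v₁, …, vₙ)` are compared lexicographically. -/
inductive OmegaPrime.DlLT : OmegaPrime ar X → OmegaPrime ar X → Prop
  | deg {p q : OmegaPrime ar X} (h : p.deg < q.deg) : OmegaPrime.DlLT p q
  | letter {x y : X} (h : x < y) : OmegaPrime.DlLT (.letter x) (.letter y)
  | symbol {ω θ : Ω} (u : Fin (ar ω) → OmegaWord ar X) (v : Fin (ar θ) → OmegaWord ar X)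
      (hd : (OmegaPrime.op ω u).deg = (OmegaPrime.op θ v).deg) (h : ω < θ) :
      OmegaPrime.DlLT (.op ω u) (.op θ v)
  | argument {ω : Ω} (u v : Fin (ar ω) → OmegaWord ar X)
      (hd : (OmegaPrime.op ω u).deg = (OmegaPrime.op ω v).deg)
      (i : Fin (ar ω)) (he : ∀ j < i, u j = v j) (h : OmegaWord.DlLT (u i) (v i)) :
      OmegaPrime.DlLT (.op ω u) (.op ω v)

/-- The order `u <_Dl v` on `Ω`-words: `(deg u, bre u, u₁, …, uₙ)` is lexicographically smaller
than `(deg v, bre v, v₁, …, vₘ)`, where `u = u₁ ⋯ uₙ` and `v = v₁ ⋯ vₘ` with all `uᵢ`, `vⱼ` prime,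
and the breadth `bre` is the number of prime factors. -/
inductive OmegaWord.DlLT : FreeSemigroup (OmegaPrime ar X) → FreeSemigroup (OmegaPrime ar X) → Prop
  | deg {u v : FreeSemigroup (OmegaPrime ar X)} (h : OmegaWord.deg u < OmegaWord.deg v) :
      OmegaWord.DlLT u v
  | breadth {u v : FreeSemigroup (OmegaPrime ar X)} (hd : OmegaWord.deg u = OmegaWord.deg v)
      (h : u.length < v.length) : OmegaWord.DlLT u v
  | factor {u v : FreeSemigroup (OmegaPrime ar X)} (hd : OmegaWord.deg u = OmegaWord.deg v)
      (hb : u.length = v.length) (c : List (OmegaPrime ar X)) (p q : OmegaPrime ar X)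
      (a b : List (OmegaPrime ar X))
      (hu : LyndonShirshov.letters u = c ++ p :: a) (hv : LyndonShirshov.letters v = c ++ q :: b)
      (h : OmegaPrime.DlLT p q) : OmegaWord.DlLT u v

end

end Order

/-! ## Non-associative `Ω`-words -/

/-- The prime non-associative `Ω`-words on `X`: the letters `x ∈ X` and the words `ω(t₁, …, tₘ)`
with non-associative words `tᵢ` in prime non-associative `Ω`-words. -/
inductive NAOmegaPrime {Ω : Type*} (ar : Ω → ℕ) (X : Type*)
  | letter (x : X) : NAOmegaPrime ar X
  | op (ω : Ω) (t : Fin (ar ω) → FreeMagma (NAOmegaPrime ar X)) : NAOmegaPrime ar X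

/-- The set `(Ω; X)` of non-associative `Ω`-words on `X`. -/
abbrev NAOmegaWord {Ω : Type*} (ar : Ω → ℕ) (X : Type*) := FreeMagma (NAOmegaPrime ar X)

section Forget

variable {Ω X : Type*} {ar : Ω → ℕ}

/-! The associative `Ω`-word underlying a non-associative one: all brackets are erased, also
those inside the arguments of the operators. -/

mutual

/-- Erasing all brackets in a prime non-associative `Ω`-word. -/
def NAOmegaPrime.forget : NAOmegaPrime ar X → OmegaPrime ar X
  | .letter x => .letter x
  | .op ω t => .op ω (fun i => NAOmegaWord.forget (t i))

/-- Erasing all brackets in a non-associative `Ω`-word. -/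
def NAOmegaWord.forget : FreeMagma (NAOmegaPrime ar X) → FreeSemigroup (OmegaPrime ar X)
  | .of p => FreeSemigroup.of (NAOmegaPrime.forget p)
  | .mul t s => NAOmegaWord.forget t * NAOmegaWord.forget s

end

end Forget

/-! ## Lyndon–Shirshov `Ω`-words -/

section LyndonShirshovOmega

variable {Ω : Type*} (ar : Ω → ℕ) {X : Type*}

/-- `X ∪ Ω(S)`: the letters and all `ω(t₁, …, tₘ)` with `tᵢ ∈ S`. -/
def naPrimesOver (S : Set (NAOmegaWord ar X)) : Set (NAOmegaPrime ar X) :=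
  {p | (∃ x : X, p = .letter x) ∨
    ∃ (ω : Ω) (t : Fin (ar ω) → NAOmegaWord ar X), (∀ i, t i ∈ S) ∧ p = .op ω t}

variable [LT X] [LT Ω]

variable {ar} in
/-- The order on bracketed primes `[u]`: `[u] ≺ [v]` if `u ≺ v`. -/
def NAOmegaPrime.DlLT (p q : NAOmegaPrime ar X) : Prop := OmegaPrime.DlLT p.forget q.forget

variable (X)

/-- `NLSW(Ω; X)ₙ`. For `n = 0` these are the non-associative Lyndon–Shirshov words on `X`. For
`n + 1` they are the non-associative Lyndon–Shirshov words on the alphabet `X ∪ Ω(NLSW(Ω; X)ₙ)`,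
which consists of the bracketed primes `x` and `ω([u₁], …, [uₘ])`. The lexicographic order is
taken with respect to `≺`. -/
def omegaNLSWLevel : ℕ → Set (NAOmegaWord ar X)
  | 0 => LyndonShirshov.NLSW NAOmegaPrime.DlLT (Set.range NAOmegaPrime.letter)
  | n + 1 => LyndonShirshov.NLSW NAOmegaPrime.DlLT (naPrimesOver ar (omegaNLSWLevel n))

/-- The set `NLSW(Ω; X)` of non-associative Lyndon–Shirshov `Ω`-words. -/
def omegaNLSW : Set (NAOmegaWord ar X) := ⋃ n, omegaNLSWLevel ar X n

end LyndonShirshovOmega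

/-! ## Lie `Ω`-algebras -/

/-- Multilinear operators `Ω` on a `k`-module `A`: each `ω ∈ Ω` acts as a `k`-multilinear
operation with `ar ω` arguments. A Lie `Ω`-algebra is a Lie algebra with such operators. -/
class OmegaOperators (k : Type*) {Ω : Type*} (ar : Ω → ℕ) (A : Type*)
    [CommSemiring k] [AddCommMonoid A] [Module k A] where
  /-- The multilinear operation of an operator. -/
  op (ω : Ω) : MultilinearMap k (fun _ : Fin (ar ω) => A) A

/-- The multilinear operation of `ω` on `A`. -/
def omegaOp (k : Type*) {Ω : Type*} (ar : Ω → ℕ) (A : Type*)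
    [CommSemiring k] [AddCommMonoid A] [Module k A] [OmegaOperators k ar A] (ω : Ω) :
    MultilinearMap k (fun _ : Fin (ar ω) => A) A :=
  OmegaOperators.op ω

section LieOmega

variable (k : Type*) {Ω : Type*} (ar : Ω → ℕ) [CommRing k]

/-- A Lie `Ω`-algebra homomorphism is a Lie algebra homomorphism that preserves all operators. -/
def IsLieOmegaHom {A B : Type*} [LieRing A] [LieAlgebra k A] [OmegaOperators k ar A]
    [LieRing B] [LieAlgebra k B] [OmegaOperators k ar B] (f : A →ₗ⁅k⁆ B) : Prop :=
  ∀ (ω : Ω) (a : Fin (ar ω) → A),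
    f (omegaOp k ar A ω a) = omegaOp k ar B ω (fun i => f (a i))

/-- `F` with the map `ι : X → F` is a free Lie `Ω`-algebra on the set `X`: `ι` is injective, and
every map from `X` to a Lie `Ω`-algebra `A` (in the universe `w`) extends uniquely along `ι` to a
Lie `Ω`-algebra homomorphism `F → A`. -/
def IsFreeLieOmegaAlgebra {F : Type*} [LieRing F] [LieAlgebra k F]
    [OmegaOperators k ar F] {X : Type*} (ι : X → F) : Prop :=
  Function.Injective ι ∧
    ∀ (A : Type w) [LieRing A] [LieAlgebra k A] [OmegaOperators k ar A] (σ : X → A),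
      ∃! f : F →ₗ⁅k⁆ A, IsLieOmegaHom k ar f ∧ ∀ x, f (ι x) = σ x

section Subalgebra

variable {A : Type*} [LieRing A] [LieAlgebra k A] [OmegaOperators k ar A] (s : Set A)

/-- The Lie `Ω`-subalgebra generated by a set `s`: the intersection of all Lie subalgebras that
contain `s` and are closed under all operators. -/
def lieOmegaSpan : LieSubalgebra k A :=
  sInf {L | s ⊆ L ∧ ∀ (ω : Ω) (a : Fin (ar ω) → A), (∀ i, a i ∈ L) → omegaOp k ar A ω a ∈ L}

variable {k ar s} in
theorem mem_lieOmegaSpan {a : A} : a ∈ lieOmegaSpan k ar s ↔ ∀ L : LieSubalgebra k A, s ⊆ L →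
    (∀ (ω : Ω) (b : Fin (ar ω) → A), (∀ i, b i ∈ L) → omegaOp k ar A ω b ∈ L) → a ∈ L := by
  rw [lieOmegaSpan, ← SetLike.mem_coe, LieSubalgebra.coe_sInf]
  simp only [Set.mem_iInter, Set.mem_ofPred_eq, SetLike.mem_coe, and_imp]

theorem subset_lieOmegaSpan : s ⊆ lieOmegaSpan k ar s := fun _ ha =>
  mem_lieOmegaSpan.2 fun _ hL _ => hL ha

theorem op_mem_lieOmegaSpan (ω : Ω) (a : Fin (ar ω) → A) (ha : ∀ i, a i ∈ lieOmegaSpan k ar s) :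
    omegaOp k ar A ω a ∈ lieOmegaSpan k ar s :=
  mem_lieOmegaSpan.2 fun L hL hop => hop ω a fun i => mem_lieOmegaSpan.1 (ha i) L hL hop

/-- The operators on the generated Lie `Ω`-subalgebra are the restrictions of those on `A`. -/
instance lieOmegaSpan.instOmegaOperators : OmegaOperators k ar (lieOmegaSpan k ar s) where
  op ω :=
    ((omegaOp k ar A ω).compLinearMap
      (fun _ => (lieOmegaSpan k ar s).toSubmodule.subtype)).codRestrict
        (lieOmegaSpan k ar s).toSubmodule
        (fun a => op_mem_lieOmegaSpan k ar s ω _ fun i => (a i).2)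

@[simp]
theorem lieOmegaSpan.coe_op (ω : Ω) (a : Fin (ar ω) → lieOmegaSpan k ar s) :
    (omegaOp k ar (lieOmegaSpan k ar s) ω a : A) =
      omegaOp k ar A ω (fun i => (a i : A)) := rfl

end Subalgebra

section Eval

variable {ar} {A : Type*} [LieRing A] [LieAlgebra k A] [OmegaOperators k ar A]
  {X : Type*} (σ : X → A)

/-! The value in a Lie `Ω`-algebra of a non-associative `Ω`-word, after the substitution
`x ↦ σ x`: brackets are read as Lie brackets and operators as operators. -/

mutual

/-- The value of a prime non-associative `Ω`-word. -/
def NAOmegaPrime.eval : NAOmegaPrime ar X → A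
  | .letter x => σ x
  | .op ω t => omegaOp k ar A ω (fun i => NAOmegaWord.eval (t i))

/-- The value of a non-associative `Ω`-word. -/
def NAOmegaWord.eval : FreeMagma (NAOmegaPrime ar X) → A
  | .of p => NAOmegaPrime.eval p
  | .mul t s => ⁅NAOmegaWord.eval t, NAOmegaWord.eval s⁆

end

end Eval

end LieOmega

/-! ## The free associative `Ω`-algebra `k⟨Ω; X⟩` and `Lie(Ω; X)` -/

noncomputable section FreeAssociative

variable (k : Type*) {Ω : Type*} (ar : Ω → ℕ) (X : Type*) [CommRing k]

/-- `k⟨Ω; X⟩`: the `k`-module with basis the set `⟨Ω; X⟩` of (nonempty) associative `Ω`-words, with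
multiplication the bilinear extension of concatenation. -/
def FreeAssocOmega := MonoidAlgebra k (OmegaWord ar X)

namespace FreeAssocOmega

instance : NonUnitalRing (FreeAssocOmega k ar X) :=
  inferInstanceAs (NonUnitalRing (MonoidAlgebra k (OmegaWord ar X)))

instance : Module k (FreeAssocOmega k ar X) :=
  inferInstanceAs (Module k (MonoidAlgebra k (OmegaWord ar X)))

instance : IsScalarTower k (FreeAssocOmega k ar X) (FreeAssocOmega k ar X) :=
  inferInstanceAs (IsScalarTower k (MonoidAlgebra k (OmegaWord ar X))
    (MonoidAlgebra k (OmegaWord ar X)))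

instance : SMulCommClass k (FreeAssocOmega k ar X) (FreeAssocOmega k ar X) :=
  inferInstanceAs (SMulCommClass k (MonoidAlgebra k (OmegaWord ar X))
    (MonoidAlgebra k (OmegaWord ar X)))

variable {ar X} in
/-- The basis element of `k⟨Ω; X⟩` given by an associative `Ω`-word. -/
def word (u : OmegaWord ar X) : FreeAssocOmega k ar X := MonoidAlgebra.single u 1

/-- The words form a basis of `k⟨Ω; X⟩`. -/
def basisWord : Module.Basis (OmegaWord ar X) k (FreeAssocOmega k ar X) :=
  .ofRepr (MonoidAlgebra.coeffLinearEquiv k)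

variable {ar X} in
@[simp]
theorem basisWord_apply (u : OmegaWord ar X) : basisWord k ar X u = word k u := rfl

variable {ar X} in
@[simp]
theorem word_mul_word (u v : OmegaWord ar X) : word k u * word k v = word k (u * v) :=
  (MonoidAlgebra.single_mul_single ..).trans (by rw [one_mul]; rfl)

/-- The Lie bracket `[a, b] = a b - b a` on `k⟨Ω; X⟩`. -/
instance : LieRing (FreeAssocOmega k ar X) where
  bracket a b := a * b - b * a
  add_lie a b c := by rw [add_mul, mul_add]; abel
  lie_add a b c := by rw [add_mul, mul_add]; abel
  lie_self a := sub_self _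
  leibniz_lie a b c := by
    change a * (b * c - c * b) - (b * c - c * b) * a =
      (a * b - b * a) * c - c * (a * b - b * a) + (b * (a * c - c * a) - (a * c - c * a) * b)
    simp only [mul_sub, sub_mul, mul_assoc]
    abel

theorem lie_def (a b : FreeAssocOmega k ar X) : ⁅a, b⁆ = a * b - b * a := rfl

instance : LieAlgebra k (FreeAssocOmega k ar X) where
  lie_smul t a b := by rw [lie_def, lie_def, mul_smul_comm, smul_mul_assoc, smul_sub]

open scoped Classical in
/-- The operator `ω` on `k⟨Ω; X⟩`: the multilinear extension of
`(u₁, …, uₘ) ↦ ω(u₁, …, uₘ)`, that is,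
`ω(f₁, …, fₘ) = ∑ f₁(u₁) ⋯ fₘ(uₘ) ω(u₁, …, uₘ)`. -/
instance : OmegaOperators k ar (FreeAssocOmega k ar X) where
  op ω :=
    (((basisWord k ar X).repr.symm.toLinearMap ∘ₗ
      Finsupp.lmapDomain k k (fun u : Fin (ar ω) → OmegaWord ar X =>
        FreeSemigroup.of (OmegaPrime.op ω u)) ∘ₗ
      PiTensorProduct.ofFinsuppEquiv'.toLinearMap).compMultilinearMap
        (PiTensorProduct.tprod k)).compLinearMap
          (fun _ => (basisWord k ar X).repr.toLinearMap)

@[simp]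
theorem op_word (ω : Ω) (u : Fin (ar ω) → OmegaWord ar X) :
    omegaOp k ar (FreeAssocOmega k ar X) ω (fun i => word k (u i)) =
      word k (FreeSemigroup.of (OmegaPrime.op ω u)) := by
  classical
  simp only [← basisWord_apply, omegaOp, OmegaOperators.op, MultilinearMap.compLinearMap_apply,
    LinearMap.compMultilinearMap_apply, LinearMap.comp_apply, LinearEquiv.coe_coe,
    Module.Basis.repr_self, PiTensorProduct.ofFinsuppEquiv'_tprod_single,
    Finsupp.lmapDomain_apply, Finsupp.mapDomain_single, Finset.prod_const_one,
    Module.Basis.repr_symm_single_one]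

variable {X} in
/-- The element `x ∈ X` of `k⟨Ω; X⟩`. -/
def letter (x : X) : FreeAssocOmega k ar X := word k (FreeSemigroup.of (OmegaPrime.letter x))

end FreeAssocOmega

/-- `Lie(Ω; X)`: the Lie `Ω`-subalgebra of `k⟨Ω; X⟩` generated by `X`. -/
abbrev LieOmega : LieSubalgebra k (FreeAssocOmega k ar X) :=
  lieOmegaSpan k ar (Set.range (FreeAssocOmega.letter k ar))

variable {X} in
/-- The element `x ∈ X` of `Lie(Ω; X)`. -/
def LieOmega.of (x : X) : LieOmega k ar X :=
  ⟨FreeAssocOmega.letter k ar x, subset_lieOmegaSpan k ar _ ⟨x, rfl⟩⟩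

end FreeAssociative

/-!
The values of the Lyndon–Shirshov `Ω`-words are shown to be linearly independent in `k⟨Ω; X⟩`, and
their span is shown to be closed under brackets and operators in every Lie `Ω`-algebra, with
structure constants that do not depend on the algebra. Both parts of the theorem follow.

* *Linear independence.* If `v w` is a Lyndon–Shirshov word, then `v w > w v`, so that the leading
  word of `[v, w] = v w - w v` is `v w`; operators are multilinear and compatible with the deg-lex
  order. Hence the value of a Lyndon–Shirshov `Ω`-word `t` has as its leading word the word obtained
  from `t` by erasing the brackets, with coefficient `1` (`isLead_eval`). These leading words are
  distinct (`forget_injOn_omegaNLSW`), as the right factor of a Lyndon–Shirshov word is its largest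
  proper suffix and the bracketing can therefore be recovered (`IsNLSW.suffix_le_right`).

* *Closure.* `NLSW(Ω; X)` is the set of Lyndon–Shirshov words on the alphabet `X ∪ Ω(NLSW(Ω; X))`
  (`omegaNLSW_eq`), which contains every `ω(t₁, …, tₘ)` with all `tᵢ` in `NLSW(Ω; X)`, so closure
  under operators is immediate. For brackets, let `l > m` be Lyndon–Shirshov words. Either
  `(l)(m)` is one too, or `l = (l₁)(l₂)` with `l₂ > m` and the Jacobi identity rewrites `[l, m]` by
  brackets whose smaller factor is greater than `m`. There are finitely many words of bounded
  length in the letters of `l` and `m`, so this ends (`lie_mem_span_valuesAbove`).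

* *Freeness.* The rewriting of brackets holds in the free Lie algebra on the set of all bracketed
  primes. So the linear map from `Lie(Ω; X)` to a Lie `Ω`-algebra which sends the value of each
  basis word to its value there respects brackets (`LieOmega.constr_lie`), and it respects operators
  because these send basis elements to basis elements (`LieOmega.isLieOmegaHom_lift`).
-/

namespace LyndonShirshov

variable {α : Type*} {lt : α → α → Prop}

/-! ### The lexicographic order -/

/-- `u` and `v` first differ at a position that both have, with the smaller letter in `u`. Unlike
`LexLT`, this relation is preserved when `u` and `v` are extended to the right. -/
def DiffLT (lt : α → α → Prop) (u v : List α) : Prop :=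
  ∃ (c : List α) (a b : α) (x y : List α), lt a b ∧ u = c ++ a :: x ∧ v = c ++ b :: y

theorem DiffLT.append {u v : List α} (h : DiffLT lt u v) (x y : List α) :
    DiffLT lt (u ++ x) (v ++ y) := by
  obtain ⟨c, a, b, x', y', hab, rfl, rfl⟩ := h
  exact ⟨c, a, b, x' ++ x, y' ++ y, hab, by simp, by simp⟩

theorem LexLT.append_left {u v : List α} (h : LexLT lt u v) (c : List α) :
    LexLT lt (c ++ u) (c ++ v) := by
  induction c with
  | nil => exact h
  | cons a c ih => exact .tail a ih

theorem lexLT_append_self {s : List α} (hs : s ≠ []) (u : List α) : LexLT lt (u ++ s) u := by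
  obtain ⟨a, s, rfl⟩ := List.exists_cons_of_ne_nil hs
  simpa using LexLT.append_left (.nil a s) u

theorem DiffLT.lexLT {u v : List α} (h : DiffLT lt u v) : LexLT lt u v := by
  obtain ⟨c, a, b, x, y, hab, rfl, rfl⟩ := h
  exact LexLT.append_left (.head hab x y) c

theorem LexLT.prefix_or_diffLT {u v : List α} (h : LexLT lt u v) :
    (∃ s, s ≠ [] ∧ u = v ++ s) ∨ DiffLT lt u v := by
  induction h with
  | nil a u => exact .inl ⟨a :: u, by simp, rfl⟩
  | @head a b h u v => exact .inr ⟨[], a, b, u, v, h, rfl, rfl⟩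
  | @tail a u v h ih =>
    obtain ⟨s, hs, rfl⟩ | ⟨c, p, q, x, y, hpq, rfl, rfl⟩ := ih
    · exact .inl ⟨s, hs, rfl⟩
    · exact .inr ⟨a :: c, p, q, x, y, hpq, rfl, rfl⟩

theorem LexLT.diffLT {u v : List α} (h : LexLT lt u v) (hl : u.length ≤ v.length) :
    DiffLT lt u v := by
  obtain ⟨s, hs, rfl⟩ | h := h.prefix_or_diffLT
  · have := List.length_pos_iff.2 hs
    simp only [List.length_append] at hl
    omega
  · exact h

/-- Transitivity, with the hypothesis on `lt` only for the letters that occur: this form is needed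
while the order on `Ω`-words and the order on their prime factors are treated by a simultaneous
recursion on the degree. -/
theorem LexLT.trans_of_mem {u v w : List α}
    (ht : ∀ a ∈ u, ∀ b ∈ v, ∀ c ∈ w, lt a b → lt b c → lt a c)
    (h : LexLT lt u v) (h' : LexLT lt v w) : LexLT lt u w := by
  induction h generalizing w with
  | nil a u => cases h'
  | head h u v =>
    cases h' with
    | nil => exact .nil _ _
    | head h' _ _ => exact .head (ht _ (by simp) _ (by simp) _ (by simp) h h') _ _
    | tail _ h' => exact .head h _ _
  | tail a h ih =>
    cases h' with
    | nil => exact .nil _ _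
    | head h' _ _ => exact .head h' _ _
    | tail _ h' =>
      exact .tail _ (ih (fun a ha b hb c hc => ht a (.tail _ ha) b (.tail _ hb) c (.tail _ hc)) h')

theorem LexLT.trans [IsTrans α lt] {u v w : List α} (h : LexLT lt u v) (h' : LexLT lt v w) :
    LexLT lt u w :=
  h.trans_of_mem (fun _ _ _ _ _ _ => IsTrans.trans _ _ _) h'

theorem LexLT.irrefl_of_mem {u : List α} (hu : ∀ a ∈ u, ¬ lt a a) : ¬ LexLT lt u u := by
  induction u with
  | nil => intro h; cases h
  | cons a u ih =>
    rw [List.forall_mem_cons] at hu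
    intro h
    cases h with
    | head h => exact hu.1 h
    | tail _ h => exact ih hu.2 h

theorem LexLT.irrefl [Std.Irrefl lt] (u : List α) : ¬ LexLT lt u u :=
  LexLT.irrefl_of_mem fun _ _ => Std.Irrefl.irrefl _

theorem LexLT.of_append_left [Std.Irrefl lt] {c u v : List α}
    (h : LexLT lt (c ++ u) (c ++ v)) : LexLT lt u v := by
  induction c with
  | nil => exact h
  | cons a c ih =>
    cases h with
    | head h => exact absurd h (Std.Irrefl.irrefl _)
    | tail _ h => exact ih h

instance [IsStrictOrder α lt] : IsStrictOrder (List α) (LexLT lt) where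
  irrefl := LexLT.irrefl
  trans _ _ _ := LexLT.trans

theorem lexLT_trichotomous {Y : Set α} (hY : ∀ a ∈ Y, ∀ b ∈ Y, lt a b ∨ a = b ∨ lt b a)
    {u v : List α} (hu : ∀ a ∈ u, a ∈ Y) (hv : ∀ a ∈ v, a ∈ Y) :
    LexLT lt u v ∨ u = v ∨ LexLT lt v u := by
  induction u generalizing v with
  | nil =>
    cases v with
    | nil => exact .inr (.inl rfl)
    | cons b v => exact .inr (.inr (.nil b v))
  | cons a u ih =>
    cases v with
    | nil => exact .inl (.nil a u)
    | cons b v =>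
      simp only [List.forall_mem_cons] at hu hv
      obtain h | rfl | h := hY a hu.1 b hv.1
      · exact .inl (.head h _ _)
      · obtain h | rfl | h := ih hu.2 hv.2
        · exact .inl (.tail _ h)
        · exact .inr (.inl rfl)
        · exact .inr (.inr (.tail _ h))
      · exact .inr (.inr (.head h _ _))

/-! ### Associative Lyndon–Shirshov words -/

/-- The condition `IsALSW` for a word given as a list of letters. -/
def ListALSW (lt : α → α → Prop) (w : List α) : Prop :=
  ∀ u v : List α, u ≠ [] → v ≠ [] → w = u ++ v → LexLT lt (v ++ u) w

@[simp]
theorem letters_of (a : α) : letters (FreeSemigroup.of a) = [a] := rfl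

@[simp]
theorem letters_mul (u v : FreeSemigroup α) : letters (u * v) = letters u ++ letters v := rfl

theorem letters_ne_nil (u : FreeSemigroup α) : letters u ≠ [] := List.cons_ne_nil _ _

theorem letters_injective : Function.Injective (letters : FreeSemigroup α → List α) := by
  rintro ⟨a, u⟩ ⟨b, v⟩ h
  simpa [letters] using h

theorem exists_letters_eq {u : List α} (hu : u ≠ []) : ∃ w : FreeSemigroup α, letters w = u := by
  obtain ⟨a, u, rfl⟩ := List.exists_cons_of_ne_nil hu
  exact ⟨⟨a, u⟩, rfl⟩

theorem isALSW_iff {w : FreeSemigroup α} : IsALSW lt w ↔ ListALSW lt (letters w) := by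
  constructor
  · intro h u v hu hv huv
    obtain ⟨u, rfl⟩ := exists_letters_eq hu
    obtain ⟨v, rfl⟩ := exists_letters_eq hv
    obtain rfl := letters_injective (huv.trans (letters_mul u v).symm)
    exact h u v rfl
  · rintro h u v rfl
    exact h _ _ (letters_ne_nil u) (letters_ne_nil v) rfl

/-- An associative Lyndon–Shirshov word is larger than its proper suffixes. -/
theorem ListALSW.suffix_lexLT [IsStrictOrder α lt] {u v : List α} (h : ListALSW lt (u ++ v))
    (hu : u ≠ []) (hv : v ≠ []) : LexLT lt v (u ++ v) := by
  have h1 := h u v hu hv rfl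
  obtain ⟨c, a, b, x, y, hab, hc, hc'⟩ :=
    h1.diffLT (by simp only [List.length_append]; omega)
  -- If `v` is a prefix, so that `u v = v z`, then comparing `u` with `z` contradicts `h`.
  have of_prefix (z : List α) (hz0 : z ≠ []) (hz : u ++ v = v ++ z) : LexLT lt v (u ++ v) := by
    have hl : z.length = u.length := by
      have := congrArg List.length hz
      simp only [List.length_append] at this
      omega
    rw [hz] at h1
    have h2 := ((h1.of_append_left.diffLT hl.ge).append v v).lexLT
    rw [hz] at h h2
    exact absurd (h2.trans (h v z hv hz0 rfl)) (LexLT.irrefl _)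
  obtain ⟨s, rfl, hs⟩ | ⟨s, rfl, hs⟩ := List.append_eq_append_iff.1 hc
  · exact of_prefix (s ++ b :: y) (by simp) (by rw [hc']; simp)
  · obtain _ | ⟨d, s⟩ := s
    · exact of_prefix (b :: y) (by simp) (by rw [hc']; simp)
    · simp only [List.cons_append, List.cons.injEq] at hs
      rw [hc', ← hs.1]
      exact DiffLT.lexLT ⟨c, a, b, s, y, hab, rfl, rfl⟩

theorem listALSW_of_suffix_lexLT [IsTrans α lt] {w : List α}
    (h : ∀ u v, u ≠ [] → v ≠ [] → w = u ++ v → LexLT lt v w) : ListALSW lt w :=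
  fun u v hu hv huv => (lexLT_append_self hu v).trans (h u v hu hv huv)

theorem ListALSW.lexLT_append [IsStrictOrder α lt] {l m : List α} (hm : ListALSW lt m)
    (hl0 : l ≠ []) (h : LexLT lt m l) : LexLT lt m (l ++ m) := by
  obtain ⟨s, hs, rfl⟩ | hd := h.prefix_or_diffLT
  · exact (hm.suffix_lexLT hl0 hs).append_left l
  · simpa using (hd.append [] m).lexLT

theorem ListALSW.append [IsStrictOrder α lt] {l m : List α} (hl : ListALSW lt l)
    (hm : ListALSW lt m) (hl0 : l ≠ []) (h : LexLT lt m l) : ListALSW lt (l ++ m) := by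
  refine listALSW_of_suffix_lexLT fun u v hu hv huv => ?_
  have hlm := hm.lexLT_append hl0 h
  obtain ⟨s, rfl, rfl⟩ | ⟨s, rfl, rfl⟩ := List.append_eq_append_iff.1 huv
  · by_cases hs : s = []
    · simpa [hs] using hlm
    · exact (hm.suffix_lexLT hs hv).trans hlm
  · by_cases hs : s = []
    · simpa [hs] using hlm
    · exact (((hl.suffix_lexLT hu hs).diffLT (by simp)).append m m).lexLT

/-! ### Non-associative Lyndon–Shirshov words -/

/-- The list of letters of a non-associative word. -/
def treeLetters (t : FreeMagma α) : List α := letters t.toFreeSemigroup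

@[simp]
theorem treeLetters_of (a : α) : treeLetters (.of a) = [a] := rfl

@[simp]
theorem treeLetters_mul (t s : FreeMagma α) :
    treeLetters (.mul t s) = treeLetters t ++ treeLetters s := rfl

theorem treeLetters_ne_nil (t : FreeMagma α) : treeLetters t ≠ [] := letters_ne_nil _

theorem isNLSW_mul {v w : FreeMagma α} : IsNLSW lt (.mul v w) ↔
    ListALSW lt (treeLetters v ++ treeLetters w) ∧ IsNLSW lt v ∧ IsNLSW lt w ∧
      RightFactorLE lt v w := by
  rw [IsNLSW, isALSW_iff, letters_mul]
  rfl

theorem rightFactorLE_mul {v₁ v₂ w : FreeMagma α} : RightFactorLE lt (.mul v₁ v₂) w ↔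
    treeLetters v₂ = treeLetters w ∨ LexLT lt (treeLetters v₂) (treeLetters w) := by
  rw [RightFactorLE, ← letters_injective.eq_iff]
  rfl

theorem isNLSW_of (a : α) : IsNLSW lt (.of a) := by
  rw [IsNLSW, isALSW_iff, letters_of]
  intro u v hu hv h
  obtain ⟨rfl, -⟩ | ⟨-, rfl⟩ := List.append_eq_singleton_iff.1 h.symm
  · exact absurd rfl hu
  · exact absurd rfl hv

theorem IsNLSW.listALSW {t : FreeMagma α} (h : IsNLSW lt t) : ListALSW lt (treeLetters t) := by
  cases t with
  | of a => exact isALSW_iff.1 h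
  | mul v w => exact (isNLSW_mul.1 h).1

/-- The right factor of a non-associative Lyndon–Shirshov word is its largest proper suffix. -/
theorem IsNLSW.suffix_le_right [IsStrictOrder α lt] {v w : FreeMagma α} (h : IsNLSW lt (.mul v w))
    {r s : List α} (hr : r ≠ []) (hs : s ≠ []) (hrs : treeLetters v ++ treeLetters w = r ++ s) :
    s = treeLetters w ∨ LexLT lt s (treeLetters w) := by
  induction v using FreeMagma.rec generalizing w r s with
  | of a =>
    obtain ⟨b, r, rfl⟩ := List.exists_cons_of_ne_nil hr
    simp only [treeLetters_of, List.cons_append, List.nil_append, List.cons.injEq] at hrs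
    obtain ⟨rfl, hrs⟩ := hrs
    by_cases hr' : r = []
    · left; simp [hrs, hr']
    · right
      have := (isNLSW_mul.1 h).2.2.1.listALSW
      rw [hrs] at this ⊢
      exact this.suffix_lexLT hr' hs
  | mul v₁ v₂ ih₁ _ =>
    obtain ⟨-, hv, hw, hc⟩ := isNLSW_mul.1 h
    rw [rightFactorLE_mul] at hc
    obtain ⟨x, hx, hx'⟩ | ⟨x, hx, hx'⟩ := List.append_eq_append_iff.1 hrs
    · by_cases hx0 : x = []
      · left; simp [hx', hx0]
      · right
        have := hw.listALSW
        rw [hx'] at this ⊢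
        exact this.suffix_lexLT hx0 hs
    · by_cases hx0 : x = []
      · left; simp [hx', hx0]
      · right
        subst hx'
        have h1 := lexLT_append_self (lt := lt) (treeLetters_ne_nil w) x
        have h2 := ih₁ hv hr hx0 hx
        rcases h2 with rfl | h2 <;> rcases hc with hc | hc
        · rwa [hc] at h1 ⊢
        · exact h1.trans hc
        · exact h1.trans (hc ▸ h2)
        · exact (h1.trans h2).trans hc

/-- The bracketing of a non-associative Lyndon–Shirshov word is determined by its letters. -/
theorem IsNLSW.eq_of_treeLetters_eq [IsStrictOrder α lt] {t s : FreeMagma α} (ht : IsNLSW lt t)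
    (hs : IsNLSW lt s) (h : treeLetters t = treeLetters s) : t = s := by
  have two_le (v w : FreeMagma α) (a : α) : treeLetters (.mul v w) ≠ [a] := by
    intro h
    rw [treeLetters_mul] at h
    obtain ⟨h, -⟩ | ⟨-, h⟩ := List.append_eq_singleton_iff.1 h
    · exact treeLetters_ne_nil _ h
    · exact treeLetters_ne_nil _ h
  induction t using FreeMagma.rec generalizing s with
  | of a =>
    cases s with
    | of b => exact congrArg _ (List.singleton_inj.1 h)
    | mul v w => exact absurd h.symm (two_le v w a)
  | mul v w ihv ihw =>
    cases s with
    | of b => exact absurd h (two_le v w b)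
    | mul v' w' =>
      rw [treeLetters_mul, treeLetters_mul] at h
      have h1 := ht.suffix_le_right (treeLetters_ne_nil _) (treeLetters_ne_nil _) h
      have h2 := hs.suffix_le_right (treeLetters_ne_nil _) (treeLetters_ne_nil _) h.symm
      have hw : treeLetters w = treeLetters w' := by
        rcases h1 with h1 | h1
        · exact h1.symm
        · rcases h2 with h2 | h2
          · exact h2
          · exact absurd (h1.trans h2) (LexLT.irrefl _)
      rw [hw] at h
      obtain ⟨-, hv, hw', -⟩ := isNLSW_mul.1 ht
      obtain ⟨-, kv, kw, -⟩ := isNLSW_mul.1 hs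
      rw [ihv hv kv (List.append_cancel_right h), ihw hw' kw hw]

/-! ### Brackets of Lyndon–Shirshov words in a Lie algebra -/

/-- The value of a non-associative word after the substitution `a ↦ f a`, with brackets read as
Lie brackets. -/
def lieEval {L : Type*} [Bracket L L] (f : α → L) : FreeMagma α → L
  | .of a => f a
  | .mul t s => ⁅lieEval f t, lieEval f s⁆

section

variable (lt) {L : Type*} [LieRing L] (f : α → L)

/-- The values of the non-associative Lyndon–Shirshov words of length `N` in letters from `F` whose
associative word is larger than `b`. -/
def valuesAbove (F : Set α) (N : ℕ) (b : List α) : Set L :=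
  lieEval f '' {n | n ∈ NLSW lt F ∧ (treeLetters n).length = N ∧ LexLT lt b (treeLetters n)}

variable {lt} (k : Type*) [CommRing k] [LieAlgebra k L]

theorem span_valuesAbove_mono [IsTrans α lt] {F : Set α} {N : ℕ} {b c : List α}
    (h : LexLT lt b c) :
    Submodule.span k (valuesAbove lt f F N c) ≤ Submodule.span k (valuesAbove lt f F N b) :=
  Submodule.span_mono (Set.image_mono fun _ hn => ⟨hn.1, hn.2.1, h.trans hn.2.2⟩)

theorem mem_NLSW_mul {F : Set α} {v w : FreeMagma α} : .mul v w ∈ NLSW lt F ↔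
    ListALSW lt (treeLetters v ++ treeLetters w) ∧ v ∈ NLSW lt F ∧ w ∈ NLSW lt F ∧
      RightFactorLE lt v w := by
  change (∀ a ∈ treeLetters (.mul v w), a ∈ F) ∧ IsNLSW lt (.mul v w) ↔
    _ ∧ ((∀ a ∈ treeLetters v, a ∈ F) ∧ _) ∧ ((∀ a ∈ treeLetters w, a ∈ F) ∧ _) ∧ _
  rw [isNLSW_mul, treeLetters_mul, List.forall_mem_append]
  tauto

theorem finite_words {F : Set α} (hF : F.Finite) (N : ℕ) :
    {w : List α | (∀ a ∈ w, a ∈ F) ∧ w.length ≤ N}.Finite := by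
  have := hF.to_subtype
  refine ((List.finite_length_le F N).image (List.map Subtype.val)).subset fun w hw => ?_
  refine ⟨w.attachWith (· ∈ F) hw.1, by simpa using hw.2, by simp⟩

/-- The rewriting of a bracket of two Lyndon–Shirshov words by the Jacobi identity. The recursion
is on the total length and then on the smaller of the two words, which increases. -/
theorem lie_mem_span_valuesAbove [IsStrictOrder α lt] {F : Set α} (hF : F.Finite)
    (hlt : ∀ a ∈ F, ∀ b ∈ F, lt a b ∨ a = b ∨ lt b a) (N : ℕ) (l m : FreeMagma α)
    (hl : l ∈ NLSW lt F) (hm : m ∈ NLSW lt F)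
    (hN : (treeLetters l).length + (treeLetters m).length = N)
    (h : LexLT lt (treeLetters m) (treeLetters l)) :
    ⁅lieEval f l, lieEval f m⁆ ∈
      Submodule.span k (valuesAbove lt f F N (treeLetters m)) := by
  induction N using Nat.strong_induction_on generalizing l m with
  | _ N ihN =>
  have hwf := (finite_words hF N).wellFoundedOn (r := Function.swap (LexLT lt))
  suffices H : ∀ b ∈ {w : List α | (∀ a ∈ w, a ∈ F) ∧ w.length ≤ N}, ∀ l ∈ NLSW lt F,
      ∀ m ∈ NLSW lt F, (treeLetters l).length + (treeLetters m).length = N →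
      treeLetters m = b → LexLT lt b (treeLetters l) →
      ⁅lieEval f l, lieEval f m⁆ ∈ Submodule.span k (valuesAbove lt f F N b) from
    H (treeLetters m) ⟨hm.1, by omega⟩ l hl m hm hN rfl h
  clear h hN hl hm l m
  intro b hbF
  apply hwf.induction hbF
  clear b hbF
  intro b hbF ihb l hl m hm hN hb h
  have key (l m : FreeMagma α) (hl : l ∈ NLSW lt F) (hm : m ∈ NLSW lt F)
      (hN : (treeLetters l).length + (treeLetters m).length = N)
      (hbl : LexLT lt b (treeLetters l)) (hbm : LexLT lt b (treeLetters m)) :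
      ⁅lieEval f l, lieEval f m⁆ ∈ Submodule.span k (valuesAbove lt f F N b) := by
    obtain h | h | h := lexLT_trichotomous hlt hl.1 hm.1
    · rw [← lie_skew]
      exact neg_mem (span_valuesAbove_mono f k hbl
        (ihb (treeLetters l) ⟨hl.1, by omega⟩ hbl m hm l hl (by omega) rfl h))
    · rw [hl.2.eq_of_treeLetters_eq hm.2 h, lie_self]
      exact zero_mem _
    · exact span_valuesAbove_mono f k hbm
        (ihb (treeLetters m) ⟨hm.1, by omega⟩ hbm l hl m hm hN rfl h)
  have key' (l : FreeMagma α) (hl : l ∈ NLSW lt F) (M : ℕ)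
      (hN : (treeLetters l).length + M = N) (hbl : LexLT lt b (treeLetters l)) (x : L)
      (hx : x ∈ Submodule.span k (valuesAbove lt f F M b)) :
      ⁅lieEval f l, x⁆ ∈ Submodule.span k (valuesAbove lt f F N b) := by
    induction hx using Submodule.span_induction with
    | mem x hx =>
      obtain ⟨n, ⟨hn, rfl, hbn⟩, rfl⟩ := hx
      exact key l n hl hn hN hbl hbn
    | zero => rw [lie_zero]; exact zero_mem _
    | add x y _ _ hx hy => rw [lie_add]; exact add_mem hx hy
    | smul c x _ hx => rw [lie_smul]; exact Submodule.smul_mem _ c hx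
  -- If `l m` is bracketed correctly, then it is itself one of the words of the span.
  have standard (hc : RightFactorLE lt l m) :
      ⁅lieEval f l, lieEval f m⁆ ∈ Submodule.span k (valuesAbove lt f F N b) := by
    have hml : LexLT lt (treeLetters m) (treeLetters l) := hb ▸ h
    refine Submodule.subset_span ⟨.mul l m, ⟨mem_NLSW_mul.2 ⟨?_, hl, hm, hc⟩, ?_, ?_⟩, rfl⟩
    · exact hl.2.listALSW.append hm.2.listALSW (treeLetters_ne_nil l) hml
    · rw [treeLetters_mul, List.length_append, hN]
    · rw [← hb, treeLetters_mul]
      exact hm.2.listALSW.lexLT_append (treeLetters_ne_nil l) hml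
  cases l with
  | of a => exact standard trivial
  | mul l₁ l₂ =>
    obtain ⟨hw, hl₁, hl₂, -⟩ := mem_NLSW_mul.1 hl
    rw [treeLetters_mul] at h hN
    rw [List.length_append] at hN
    have h1 := List.length_pos_iff.2 (treeLetters_ne_nil l₁)
    have h2 := List.length_pos_iff.2 (treeLetters_ne_nil l₂)
    by_cases hc : RightFactorLE lt (.mul l₁ l₂) m
    · exact standard hc
    have hml₂ : LexLT lt b (treeLetters l₂) := by
      rw [rightFactorLE_mul, not_or] at hc
      obtain h | h | h := lexLT_trichotomous hlt hl₂.1 hm.1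
      · exact absurd h hc.2
      · exact absurd h hc.1
      · exact hb ▸ h
    have hml₁ : LexLT lt b (treeLetters l₁) :=
      h.trans (lexLT_append_self (treeLetters_ne_nil l₂) _)
    change ⁅⁅lieEval f l₁, lieEval f l₂⁆, lieEval f m⁆ ∈ _
    rw [lie_lie]
    subst hb
    refine sub_mem (key' l₁ hl₁ _ (by omega) hml₁ _ (ihN _ ?_ l₂ m hl₂ hm rfl hml₂))
      (key' l₂ hl₂ _ ?_ hml₂ _ (ihN _ ?_ l₁ m hl₁ hm rfl hml₁)) <;> omega

/-- The values of the Lyndon–Shirshov words on `Y` span a Lie subalgebra. -/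
theorem lie_mem_span_NLSW [IsStrictOrder α lt] {Y : Set α}
    (hlt : ∀ a ∈ Y, ∀ b ∈ Y, lt a b ∨ a = b ∨ lt b a) {l m : FreeMagma α}
    (hl : l ∈ NLSW lt Y) (hm : m ∈ NLSW lt Y) :
    ⁅lieEval f l, lieEval f m⁆ ∈ Submodule.span k (lieEval f '' NLSW lt Y) := by
  -- The recursion takes place in the finite alphabet of the letters of `l` and `m`.
  let F : Set α := {a | a ∈ treeLetters l ++ treeLetters m}
  have hFY : F ⊆ Y := fun a ha => (List.mem_append.1 ha).elim (hl.1 a) (hm.1 a)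
  have hF : F.Finite := List.finite_toSet _
  have hltF : ∀ a ∈ F, ∀ b ∈ F, lt a b ∨ a = b ∨ lt b a :=
    fun a ha b hb => hlt a (hFY ha) b (hFY hb)
  have hlF : l ∈ NLSW lt F := ⟨fun a ha => List.mem_append_left _ ha, hl.2⟩
  have hmF : m ∈ NLSW lt F := ⟨fun a ha => List.mem_append_right _ ha, hm.2⟩
  have hmono (N : ℕ) (b : List α) : Submodule.span k (valuesAbove lt f F N b) ≤
      Submodule.span k (lieEval f '' NLSW lt Y) :=
    Submodule.span_mono (Set.image_mono fun n hn => ⟨fun a ha => hFY (hn.1.1 a ha), hn.1.2⟩)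
  obtain h | h | h := lexLT_trichotomous hltF hlF.1 hmF.1
  · rw [← lie_skew]
    exact neg_mem (hmono _ _ (lie_mem_span_valuesAbove f k hF hltF _ m l hmF hlF rfl h))
  · rw [hl.2.eq_of_treeLetters_eq hm.2 h, lie_self]
    exact zero_mem _
  · exact hmono _ _ (lie_mem_span_valuesAbove f k hF hltF _ l m hlF hmF rfl h)

end

end LyndonShirshov

/-! ### The deg-lex order on associative `Ω`-words -/

open LyndonShirshov

section Order

variable {Ω X : Type*} {ar : Ω → ℕ}

theorem OmegaWord.degList_eq_sum (l : List (OmegaPrime ar X)) :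
    OmegaWord.degList l = (l.map OmegaPrime.deg).sum := by
  induction l with
  | nil => simp [OmegaWord.degList]
  | cons p l ih => simp [OmegaWord.degList, ih]

theorem OmegaWord.deg_eq_sum (u : OmegaWord ar X) :
    OmegaWord.deg u = ((letters u).map OmegaPrime.deg).sum := by
  obtain ⟨p, l⟩ := u
  simp [OmegaWord.deg, OmegaWord.degList_eq_sum, letters]

@[simp]
theorem OmegaWord.deg_of (p : OmegaPrime ar X) : OmegaWord.deg (.of p) = p.deg := by
  simp [OmegaWord.deg_eq_sum]

@[simp]
theorem OmegaWord.deg_mul (u v : OmegaWord ar X) :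
    OmegaWord.deg (u * v) = OmegaWord.deg u + OmegaWord.deg v := by
  simp [OmegaWord.deg_eq_sum]

@[simp]
theorem OmegaPrime.deg_letter (x : X) : (OmegaPrime.letter x : OmegaPrime ar X).deg = 1 := by
  simp [OmegaPrime.deg]

theorem OmegaPrime.deg_op (ω : Ω) (u : Fin (ar ω) → OmegaWord ar X) :
    (OmegaPrime.op ω u).deg = 1 + ∑ i, OmegaWord.deg (u i) := by
  simp [OmegaPrime.deg]

theorem OmegaPrime.deg_pos (p : OmegaPrime ar X) : 0 < p.deg := by
  cases p with
  | letter x => simp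
  | op ω u => rw [OmegaPrime.deg_op]; omega

theorem OmegaPrime.deg_le_of_mem {p : OmegaPrime ar X} {u : OmegaWord ar X}
    (hp : p ∈ letters u) : p.deg ≤ OmegaWord.deg u := by
  rw [OmegaWord.deg_eq_sum]
  exact List.single_le_sum (by simp) _ (List.mem_map_of_mem hp)

theorem OmegaWord.deg_pos (u : OmegaWord ar X) : 0 < OmegaWord.deg u :=
  (OmegaPrime.deg_pos u.head).trans_le (OmegaPrime.deg_le_of_mem (by simp [letters]))

theorem OmegaPrime.deg_arg_lt (ω : Ω) (u : Fin (ar ω) → OmegaWord ar X) (i : Fin (ar ω)) :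
    OmegaWord.deg (u i) < (OmegaPrime.op ω u).deg := by
  rw [OmegaPrime.deg_op]
  have := Finset.single_le_sum (f := fun i => OmegaWord.deg (u i)) (fun _ _ => Nat.zero_le _)
    (Finset.mem_univ i)
  omega

/-- An operator word has a degree greater than that of a letter, since no operator is nullary. -/
theorem OmegaPrime.one_lt_deg_op (har : ∀ ω, 1 ≤ ar ω) (ω : Ω)
    (u : Fin (ar ω) → OmegaWord ar X) : 1 < (OmegaPrime.op ω u).deg :=
  Nat.lt_of_le_of_lt (OmegaWord.deg_pos (u ⟨0, har ω⟩)) (OmegaPrime.deg_arg_lt ω u _)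

section

variable [LT X] [LT Ω]

theorem OmegaPrime.DlLT.deg_le {p q : OmegaPrime ar X} (h : p.DlLT q) : p.deg ≤ q.deg := by
  cases h with
  | deg h => exact h.le
  | letter h => simp
  | symbol u v hd h => exact hd.le
  | argument u v hd i he h => exact hd.le

theorem OmegaWord.dlLT_iff {u v : OmegaWord ar X} : OmegaWord.DlLT u v ↔
    OmegaWord.deg u < OmegaWord.deg v ∨ OmegaWord.deg u = OmegaWord.deg v ∧
      (u.length < v.length ∨ u.length = v.length ∧
        LexLT OmegaPrime.DlLT (letters u) (letters v)) := by
  constructor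
  · intro h
    cases h with
    | deg h => exact .inl h
    | breadth hd h => exact .inr ⟨hd, .inl h⟩
    | factor hd hb c p q a b hu hv h =>
      exact .inr ⟨hd, .inr ⟨hb, DiffLT.lexLT ⟨c, p, q, a, b, h, hu, hv⟩⟩⟩
  · rintro (h | ⟨hd, h | ⟨hb, h⟩⟩)
    · exact .deg h
    · exact .breadth hd h
    · obtain ⟨c, p, q, a, b, h, hu, hv⟩ := h.diffLT hb.le
      exact .factor hd hb c p q a b hu hv h

theorem OmegaWord.dlLT_irrefl_of_mem {u : OmegaWord ar X}
    (hu : ∀ p ∈ letters u, ¬ OmegaPrime.DlLT p p) : ¬ OmegaWord.DlLT u u := by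
  rw [OmegaWord.dlLT_iff]
  rintro (h | ⟨-, h | ⟨-, h⟩⟩)
  · exact lt_irrefl _ h
  · exact lt_irrefl _ h
  · exact LexLT.irrefl_of_mem hu h

theorem OmegaWord.DlLT.trans_of_mem {u v w : OmegaWord ar X}
    (ht : ∀ p ∈ letters u, ∀ q ∈ letters v, ∀ r ∈ letters w, p.DlLT q → q.DlLT r → p.DlLT r)
    (h : OmegaWord.DlLT u v) (h' : OmegaWord.DlLT v w) : OmegaWord.DlLT u w := by
  rw [OmegaWord.dlLT_iff] at *
  rcases h with h | ⟨hd, h | ⟨hb, h⟩⟩ <;> rcases h' with h' | ⟨hd', h' | ⟨hb', h'⟩⟩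
  all_goals first
    | exact .inr ⟨hd.trans hd', .inr ⟨hb.trans hb', h.trans_of_mem ht h'⟩⟩
    | omega

theorem OmegaWord.dlLT_trichotomous_of {Y : Set (OmegaPrime ar X)}
    (hY : ∀ p ∈ Y, ∀ q ∈ Y, p.DlLT q ∨ p = q ∨ q.DlLT p) {u v : OmegaWord ar X}
    (hu : ∀ p ∈ letters u, p ∈ Y) (hv : ∀ p ∈ letters v, p ∈ Y) :
    OmegaWord.DlLT u v ∨ u = v ∨ OmegaWord.DlLT v u := by
  obtain hd | hd | hd := lt_trichotomy (OmegaWord.deg u) (OmegaWord.deg v)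
  · exact .inl (.deg hd)
  · obtain hb | hb | hb := lt_trichotomy u.length v.length
    · exact .inl (.breadth hd hb)
    · obtain h | h | h := lexLT_trichotomous hY hu hv
      · exact .inl (OmegaWord.dlLT_iff.2 (.inr ⟨hd, .inr ⟨hb, h⟩⟩))
      · exact .inr (.inl (letters_injective h))
      · exact .inr (.inr (OmegaWord.dlLT_iff.2 (.inr ⟨hd.symm, .inr ⟨hb.symm, h⟩⟩)))
    · exact .inr (.inr (.breadth hd.symm hb))
  · exact .inr (.inr (.deg hd))

end

variable [LinearOrder X] [LinearOrder Ω]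

theorem OmegaPrime.dlLT_irrefl (p : OmegaPrime ar X) : ¬ p.DlLT p := by
  induction hn : p.deg using Nat.strong_induction_on generalizing p with
  | _ n ih =>
  subst hn
  intro h
  cases h with
  | deg h => exact lt_irrefl _ h
  | letter h => exact lt_irrefl _ h
  | symbol u v hd h => exact lt_irrefl _ h
  | @argument ω u v hd i he h =>
    exact OmegaWord.dlLT_irrefl_of_mem (fun p hp => ih _ ((OmegaPrime.deg_le_of_mem hp).trans_lt
      (OmegaPrime.deg_arg_lt ω u i)) p rfl) h

theorem OmegaPrime.DlLT.trans {p q r : OmegaPrime ar X} (h : p.DlLT q) (h' : q.DlLT r) :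
    p.DlLT r := by
  induction hn : p.deg using Nat.strong_induction_on generalizing p q r with
  | _ n ih =>
  subst hn
  have hpq := h.deg_le
  have hqr := h'.deg_le
  by_cases hpr : p.deg < r.deg
  · exact .deg hpr
  cases h with
  | deg h => omega
  | letter h =>
    cases h' with
    | deg h' => omega
    | letter h' => exact .letter (h.trans h')
  | symbol u v hd h =>
    cases h' with
    | deg h' => omega
    | symbol _ w hd' h' => exact .symbol u w (hd.trans hd') (h.trans h')
    | argument _ w hd' i he h' => exact .symbol u w (hd.trans hd') h
  | @argument ω u v hd i he h =>
    cases h' with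
    | deg h' => omega
    | symbol _ w hd' h' => exact .symbol u w (hd.trans hd') h'
    | argument _ w hd' i' he' h' =>
      obtain hi | rfl | hi := lt_trichotomy i i'
      · exact .argument u w (hd.trans hd') i (fun j hj => (he j hj).trans (he' j (hj.trans hi)))
          (he' i hi ▸ h)
      · refine .argument u w (hd.trans hd') i (fun j hj => (he j hj).trans (he' j hj))
          (h.trans_of_mem (fun p hp q _ r _ hpq hqr => ih _ ?_ hpq hqr rfl) h')
        exact (OmegaPrime.deg_le_of_mem hp).trans_lt (OmegaPrime.deg_arg_lt ω u i)
      · exact .argument u w (hd.trans hd') i' (fun j hj => (he j (hj.trans hi)).trans (he' j hj))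
          (he i' hi ▸ h')

theorem OmegaPrime.dlLT_trichotomous (har : ∀ ω, 1 ≤ ar ω) (p q : OmegaPrime ar X) :
    p.DlLT q ∨ p = q ∨ q.DlLT p := by
  induction hn : p.deg using Nat.strong_induction_on generalizing p q with
  | _ n ih =>
  subst hn
  obtain hd | hd | hd := lt_trichotomy p.deg q.deg
  · exact .inl (.deg hd)
  · cases p with
    | letter x =>
      cases q with
      | letter y =>
        obtain h | rfl | h := lt_trichotomy x y
        · exact .inl (.letter h)
        · exact .inr (.inl rfl)
        · exact .inr (.inr (.letter h))
      | op θ v =>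
        have := OmegaPrime.one_lt_deg_op har θ v
        rw [← hd, OmegaPrime.deg_letter] at this
        omega
    | op ω u =>
      cases q with
      | letter y =>
        have := OmegaPrime.one_lt_deg_op har ω u
        rw [hd, OmegaPrime.deg_letter] at this
        omega
      | op θ v =>
        obtain h | rfl | h := lt_trichotomy ω θ
        · exact .inl (.symbol u v hd h)
        · by_cases huv : u = v
          · exact .inr (.inl (huv ▸ rfl))
          obtain ⟨i, hi, hmin⟩ := WellFounded.has_min (wellFounded_lt (α := Fin (ar ω)))
            {i | u i ≠ v i} (Function.ne_iff.1 huv)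
          have he : ∀ j < i, u j = v j := fun j hj => by_contra fun h => hmin j h hj
          obtain h | h | h := OmegaWord.dlLT_trichotomous_of
            (Y := {p | p.deg < (OmegaPrime.op ω u).deg})
            (fun p hp q _ => ih _ hp p q rfl)
            (fun p hp => (OmegaPrime.deg_le_of_mem hp).trans_lt (OmegaPrime.deg_arg_lt ω u i))
            (fun p hp => hd ▸
              (OmegaPrime.deg_le_of_mem hp).trans_lt (OmegaPrime.deg_arg_lt ω v i))
          · exact .inl (.argument u v hd i he h)
          · exact absurd h hi
          · exact .inr (.inr (.argument v u hd.symm i (fun j hj => (he j hj).symm) h))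
        · exact .inr (.inr (.symbol v u hd.symm h))
  · exact .inr (.inr (.deg hd))

instance : IsStrictOrder (OmegaPrime ar X) OmegaPrime.DlLT where
  irrefl := OmegaPrime.dlLT_irrefl
  trans _ _ _ := OmegaPrime.DlLT.trans

instance : IsStrictOrder (NAOmegaPrime ar X) NAOmegaPrime.DlLT where
  irrefl p := OmegaPrime.dlLT_irrefl p.forget
  trans _ _ _ := OmegaPrime.DlLT.trans

end Order

/-! ### Lyndon–Shirshov `Ω`-words are determined by their associative `Ω`-words -/

theorem LyndonShirshov.LexLT.map {α β : Type*} {lt : α → α → Prop} {lt' : β → β → Prop}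
    {g : α → β} (hg : ∀ a b, lt a b → lt' (g a) (g b)) {u v : List α} (h : LexLT lt u v) :
    LexLT lt' (u.map g) (v.map g) := by
  induction h with
  | nil a u => exact .nil _ _
  | head h u v => exact .head (hg _ _ h) _ _
  | tail a h ih => exact .tail _ ih

section Forget

variable {Ω X : Type*} {ar : Ω → ℕ}

@[simp]
theorem NAOmegaWord.forget_of (p : NAOmegaPrime ar X) :
    NAOmegaWord.forget (.of p) = .of p.forget := by
  simp [NAOmegaWord.forget]

@[simp]
theorem NAOmegaWord.forget_mul (t s : NAOmegaWord ar X) :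
    NAOmegaWord.forget (.mul t s) = NAOmegaWord.forget t * NAOmegaWord.forget s := by
  rw [NAOmegaWord.forget]

theorem NAOmegaWord.letters_forget (t : NAOmegaWord ar X) :
    letters (NAOmegaWord.forget t) = (treeLetters t).map NAOmegaPrime.forget := by
  induction t using FreeMagma.rec with
  | of p => simp
  | mul t s iht ihs =>
    rw [NAOmegaWord.forget_mul, letters_mul, iht, ihs, treeLetters_mul, List.map_append]

theorem List.eq_of_map_eq_of_injOn {α β : Type*} {g : α → β} {s : Set α} (hg : s.InjOn g)
    {u v : List α} (hu : ∀ a ∈ u, a ∈ s) (hv : ∀ a ∈ v, a ∈ s) (h : u.map g = v.map g) :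
    u = v := by
  induction u generalizing v with
  | nil => simpa [eq_comm] using h
  | cons a u ih =>
    obtain _ | ⟨b, v⟩ := v
    · simp at h
    · simp only [List.forall_mem_cons, List.map_cons, List.cons.injEq] at hu hv h
      rw [hg hu.1 hv.1 h.1, ih hu.2 hv.2 h.2]

theorem forget_injOn_naPrimesOver {S : Set (NAOmegaWord ar X)} (hS : S.InjOn NAOmegaWord.forget) :
    (naPrimesOver ar S).InjOn NAOmegaPrime.forget := by
  rintro _ (⟨x, rfl⟩ | ⟨ω, t, ht, rfl⟩) _ (⟨y, rfl⟩ | ⟨θ, s, hs, rfl⟩) h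
  · simpa [NAOmegaPrime.forget] using h
  · simp [NAOmegaPrime.forget] at h
  · simp [NAOmegaPrime.forget] at h
  · simp only [NAOmegaPrime.forget, OmegaPrime.op.injEq] at h
    obtain ⟨rfl, h⟩ := h
    rw [heq_iff_eq, funext_iff] at h
    rw [funext fun i => hS (ht i) (hs i) (h i)]

theorem naPrimesOver_mono {S T : Set (NAOmegaWord ar X)} (h : S ⊆ T) :
    naPrimesOver ar S ⊆ naPrimesOver ar T := by
  rintro _ (⟨x, rfl⟩ | ⟨ω, t, ht, rfl⟩)
  · exact .inl ⟨x, rfl⟩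
  · exact .inr ⟨ω, t, fun i => h (ht i), rfl⟩

theorem LyndonShirshov.NLSW_mono {α : Type*} {lt : α → α → Prop} {Y Z : Set α} (h : Y ⊆ Z) :
    NLSW lt Y ⊆ NLSW lt Z := fun _ ht => ⟨fun a ha => h (ht.1 a ha), ht.2⟩

variable [LinearOrder X] [LinearOrder Ω]

theorem forget_injOn_NLSW {Y : Set (NAOmegaPrime ar X)} (hY : Y.InjOn NAOmegaPrime.forget) :
    (NLSW NAOmegaPrime.DlLT Y).InjOn NAOmegaWord.forget := by
  intro t ht s hs h
  refine ht.2.eq_of_treeLetters_eq hs.2 (List.eq_of_map_eq_of_injOn hY ht.1 hs.1 ?_)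
  rw [← NAOmegaWord.letters_forget, h, NAOmegaWord.letters_forget]

theorem omegaNLSWLevel_mono : Monotone (omegaNLSWLevel ar X) := by
  refine monotone_nat_of_le_succ fun n => ?_
  induction n with
  | zero => exact NLSW_mono (by rintro _ ⟨x, rfl⟩; exact .inl ⟨x, rfl⟩)
  | succ n ih => exact NLSW_mono (naPrimesOver_mono ih)

theorem omegaNLSWLevel_subset (n : ℕ) : omegaNLSWLevel ar X n ⊆ omegaNLSW ar X :=
  Set.subset_iUnion _ n

variable (ar X) in
/-- `NLSW(Ω; X)` is the set of Lyndon–Shirshov words on the alphabet `X ∪ Ω(NLSW(Ω; X))`. -/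
theorem omegaNLSW_eq :
    omegaNLSW ar X = NLSW NAOmegaPrime.DlLT (naPrimesOver ar (omegaNLSW ar X)) := by
  apply Set.Subset.antisymm
  · intro t ht
    obtain ⟨n, hn⟩ := Set.mem_iUnion.1 ht
    exact NLSW_mono (naPrimesOver_mono (omegaNLSWLevel_subset n))
      (omegaNLSWLevel_mono n.le_succ hn)
  · have prime (p : NAOmegaPrime ar X) (hp : p ∈ naPrimesOver ar (omegaNLSW ar X)) :
        ∃ n, p ∈ naPrimesOver ar (omegaNLSWLevel ar X n) := by
      obtain ⟨x, rfl⟩ | ⟨ω, t, ht, rfl⟩ := hp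
      · exact ⟨0, .inl ⟨x, rfl⟩⟩
      · choose n hn using fun i => Set.mem_iUnion.1 (ht i)
        exact ⟨Finset.univ.sup n, .inr ⟨ω, t, fun i =>
          omegaNLSWLevel_mono (Finset.le_sup (Finset.mem_univ i)) (hn i), rfl⟩⟩
    have list (l : List (NAOmegaPrime ar X)) (hl : ∀ p ∈ l, p ∈ naPrimesOver ar (omegaNLSW ar X)) :
        ∃ n, ∀ p ∈ l, p ∈ naPrimesOver ar (omegaNLSWLevel ar X n) := by
      induction l with
      | nil => exact ⟨0, by simp⟩
      | cons p l ih =>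
        rw [List.forall_mem_cons] at hl
        obtain ⟨m, hm⟩ := prime p hl.1
        obtain ⟨n, hn⟩ := ih hl.2
        refine ⟨max m n, List.forall_mem_cons.2 ⟨?_, fun q hq => ?_⟩⟩
        · exact naPrimesOver_mono (omegaNLSWLevel_mono (le_max_left m n)) hm
        · exact naPrimesOver_mono (omegaNLSWLevel_mono (le_max_right m n)) (hn q hq)
    intro t ht
    obtain ⟨n, hn⟩ := list _ ht.1
    exact omegaNLSWLevel_subset (n + 1) ⟨hn, ht.2⟩

theorem forget_injOn_omegaNLSW : (omegaNLSW ar X).InjOn NAOmegaWord.forget := by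
  have level (n : ℕ) : (omegaNLSWLevel ar X n).InjOn NAOmegaWord.forget := by
    induction n with
    | zero =>
      refine forget_injOn_NLSW ?_
      rintro _ ⟨x, rfl⟩ _ ⟨y, rfl⟩ h
      simpa [NAOmegaPrime.forget] using h
    | succ n ih => exact forget_injOn_NLSW (forget_injOn_naPrimesOver ih)
  intro t ht s hs h
  obtain ⟨m, hm⟩ := Set.mem_iUnion.1 ht
  obtain ⟨n, hn⟩ := Set.mem_iUnion.1 hs
  exact level (max m n) (omegaNLSWLevel_mono (le_max_left m n) hm)
    (omegaNLSWLevel_mono (le_max_right m n) hn) h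

/-- The order on bracketed primes is total on the alphabet of `NLSW(Ω; X)`, although it is not so
on all bracketed primes: different bracketings of a word are incomparable. -/
theorem NAOmegaPrime.dlLT_trichotomous (har : ∀ ω, 1 ≤ ar ω) {p q : NAOmegaPrime ar X}
    (hp : p ∈ naPrimesOver ar (omegaNLSW ar X)) (hq : q ∈ naPrimesOver ar (omegaNLSW ar X)) :
    p.DlLT q ∨ p = q ∨ q.DlLT p := by
  obtain h | h | h := OmegaPrime.dlLT_trichotomous har p.forget q.forget
  · exact .inl h
  · exact .inr (.inl (forget_injOn_naPrimesOver forget_injOn_omegaNLSW hp hq h))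
  · exact .inr (.inr h)

theorem of_mem_omegaNLSW {p : NAOmegaPrime ar X} (hp : p ∈ naPrimesOver ar (omegaNLSW ar X)) :
    FreeMagma.of p ∈ omegaNLSW ar X := by
  rw [omegaNLSW_eq]
  exact ⟨fun a ha => List.mem_singleton.1 ha ▸ hp, isNLSW_of p⟩

theorem letter_mem_omegaNLSW (x : X) :
    (FreeMagma.of (.letter x) : NAOmegaWord ar X) ∈ omegaNLSW ar X :=
  of_mem_omegaNLSW (.inl ⟨x, rfl⟩)

theorem op_mem_omegaNLSW {ω : Ω} {t : Fin (ar ω) → NAOmegaWord ar X}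
    (ht : ∀ i, t i ∈ omegaNLSW ar X) : FreeMagma.of (.op ω t) ∈ omegaNLSW ar X :=
  of_mem_omegaNLSW (.inr ⟨ω, t, ht, rfl⟩)

end Forget

/-! ### Leading words -/

section Multilinear

variable {k : Type*} [CommSemiring k] {ι : Type*} [Finite ι] {M : ι → Type*} {N : Type*}
  [∀ i, AddCommMonoid (M i)] [∀ i, Module k (M i)] [AddCommMonoid N] [Module k N]

theorem MultilinearMap.map_mem_of_mem_span (g : MultilinearMap k M N) (P : Submodule k N)
    (S : ∀ i, Set (M i)) (hg : ∀ y, (∀ i, y i ∈ S i) → g y ∈ P) (x : ∀ i, M i)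
    (hx : ∀ i, x i ∈ Submodule.span k (S i)) : g x ∈ P := by
  classical
  cases nonempty_fintype ι
  suffices H : ∀ (s : Finset ι) (x : ∀ i, M i), (∀ i ∈ s, x i ∈ Submodule.span k (S i)) →
      (∀ i ∉ s, x i ∈ S i) → g x ∈ P from
    H Finset.univ x (fun i _ => hx i) (fun i hi => absurd (Finset.mem_univ i) hi)
  intro s
  induction s using Finset.induction_on with
  | empty => exact fun x _ hx => hg x fun i => hx i (by simp)
  | insert j s hj ih =>
    intro x hx hx'
    have key (y : M j) (hy : y ∈ Submodule.span k (S j)) : g (Function.update x j y) ∈ P := by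
      induction hy using Submodule.span_induction with
      | mem y hy =>
        refine ih _ (fun i hi => ?_) (fun i hi => ?_)
        · rw [Function.update_of_ne (ne_of_mem_of_not_mem hi hj)]
          exact hx i (Finset.mem_insert_of_mem hi)
        · obtain rfl | hij := eq_or_ne i j
          · rwa [Function.update_self]
          · rw [Function.update_of_ne hij]
            exact hx' i (by simp [hij, hi])
      | zero => rw [g.map_update_zero]; exact P.zero_mem
      | add y z _ _ hy hz => rw [g.map_update_add]; exact P.add_mem hy hz
      | smul c y _ hy => rw [g.map_update_smul]; exact P.smul_mem c hy
    simpa using key (x j) (hx j (Finset.mem_insert_self j s))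

end Multilinear

section Below

variable {Ω X : Type*} {ar : Ω → ℕ} [LinearOrder X] [LinearOrder Ω]

/-- `v` precedes `u` in the deg-lex order and has the same degree and the same number of prime
factors. All words in the value of a Lyndon–Shirshov word `t` other than the word underlying `t`
are in this relation to it. -/
def OmegaWord.Below (v u : OmegaWord ar X) : Prop :=
  OmegaWord.deg v = OmegaWord.deg u ∧ v.length = u.length ∧
    LexLT OmegaPrime.DlLT (letters v) (letters u)

namespace OmegaWord

theorem Below.dlLT {v u : OmegaWord ar X} (h : Below v u) : OmegaWord.DlLT v u :=
  OmegaWord.dlLT_iff.2 (.inr ⟨h.1, .inr h.2⟩)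

instance : IsStrictOrder (OmegaWord ar X) Below where
  irrefl _ h := LexLT.irrefl _ h.2.2
  trans _ _ _ h h' := ⟨h.1.trans h'.1, h.2.1.trans h'.2.1, h.2.2.trans h'.2.2⟩

theorem Below.mul_right {v u : OmegaWord ar X} (h : Below v u) (w : OmegaWord ar X) :
    Below (v * w) (u * w) := by
  refine ⟨by simp [h.1], by simp [h.2.1], ?_⟩
  exact ((h.2.2.diffLT h.2.1.le).append _ _).lexLT

theorem Below.mul_left {v u : OmegaWord ar X} (h : Below v u) (w : OmegaWord ar X) :
    Below (w * v) (w * u) :=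
  ⟨by simp [h.1], by simp [h.2.1], h.2.2.append_left (letters w)⟩

theorem below_op (ω : Ω) {r u : Fin (ar ω) → OmegaWord ar X} (hne : r ≠ u)
    (h : ∀ i, r i = u i ∨ Below (r i) (u i)) :
    Below (.of (.op ω r)) (.of (.op ω u)) := by
  have hd : (OmegaPrime.op ω r).deg = (OmegaPrime.op ω u).deg := by
    rw [OmegaPrime.deg_op, OmegaPrime.deg_op]
    exact congrArg _ (Finset.sum_congr rfl fun i _ => (h i).elim (congrArg _) And.left)
  obtain ⟨i, hi, hmin⟩ := WellFounded.has_min (wellFounded_lt (α := Fin (ar ω)))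
    {i | r i ≠ u i} (Function.ne_iff.1 hne)
  exact ⟨by simpa using hd, rfl, .head (.argument r u hd i
    (fun j hj => by_contra fun h => hmin j h hj) ((h i).resolve_left hi).dlLT) [] []⟩

end OmegaWord

end Below

section Lead

variable {k : Type*} {Ω X : Type*} {ar : Ω → ℕ} [CommRing k] [LinearOrder X] [LinearOrder Ω]

open FreeAssocOmega OmegaWord

variable (k) in
/-- The span of the words below `u`. -/
noncomputable def lowerSpan (u : OmegaWord ar X) : Submodule k (FreeAssocOmega k ar X) :=
  Submodule.span k (word k '' {v | Below v u})

/-- `f` has the leading word `u` with coefficient `1`, and all its other words are below `u`. -/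
def IsLead (u : OmegaWord ar X) (f : FreeAssocOmega k ar X) : Prop :=
  f - word k u ∈ lowerSpan k u

theorem word_mem_lowerSpan {u v : OmegaWord ar X} (h : Below v u) : word k v ∈ lowerSpan k u :=
  Submodule.subset_span ⟨v, h, rfl⟩

theorem lowerSpan_mono {u v : OmegaWord ar X} (h : Below v u) : lowerSpan k v ≤ lowerSpan k u :=
  Submodule.span_mono (Set.image_mono fun _ hw =>
    _root_.trans (r := Below) hw h)

theorem isLead_word (u : OmegaWord ar X) : IsLead u (word k u) := by
  rw [IsLead, sub_self]
  exact zero_mem _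

theorem IsLead.mul {u v : OmegaWord ar X} {f g : FreeAssocOmega k ar X} (hf : IsLead u f)
    (hg : IsLead v g) : IsLead (u * v) (f * g) := by
  have h1 (w : OmegaWord ar X) (x : FreeAssocOmega k ar X) (hx : x ∈ lowerSpan k w)
      (z : OmegaWord ar X) : x * word k z ∈ lowerSpan k (w * z) := by
    induction hx using Submodule.span_induction with
    | mem x hx =>
      obtain ⟨y, hy, rfl⟩ := hx
      rw [word_mul_word]
      exact word_mem_lowerSpan (hy.mul_right z)
    | zero => rw [zero_mul]; exact zero_mem _
    | add x y _ _ hx hy => rw [add_mul]; exact add_mem hx hy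
    | smul c x _ hx => rw [smul_mul_assoc]; exact Submodule.smul_mem _ c hx
  have h2 (x : FreeAssocOmega k ar X) (hx : x ∈ lowerSpan k v) :
      f * x ∈ lowerSpan k (u * v) := by
    induction hx using Submodule.span_induction with
    | mem x hx =>
      obtain ⟨y, hy, rfl⟩ := hx
      have h := lowerSpan_mono (hy.mul_left u) (h1 u _ hf y)
      rw [sub_mul, word_mul_word] at h
      rw [← sub_add_cancel (f * word k y) (word k (u * y))]
      exact add_mem h (word_mem_lowerSpan (hy.mul_left u))
    | zero => rw [mul_zero]; exact zero_mem _
    | add x y _ _ hx hy => rw [mul_add]; exact add_mem hx hy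
    | smul c x _ hx => rw [mul_smul_comm]; exact Submodule.smul_mem _ c hx
  have h : f * g - word k (u * v) = f * (g - word k v) + (f - word k u) * word k v := by
    rw [mul_sub, sub_mul, word_mul_word]
    abel
  rw [IsLead, h]
  exact add_mem (h2 _ hg) (h1 u _ hf v)

theorem IsLead.lie {u v : OmegaWord ar X} {f g : FreeAssocOmega k ar X} (hf : IsLead u f)
    (hg : IsLead v g) (h : Below (v * u) (u * v)) : IsLead (u * v) ⁅f, g⁆ := by
  have h1 : g * f ∈ lowerSpan k (u * v) := by
    rw [← sub_add_cancel (g * f) (word k (v * u))]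
    exact add_mem (lowerSpan_mono h (hg.mul hf)) (word_mem_lowerSpan h)
  rw [IsLead, lie_def, sub_right_comm]
  exact sub_mem (hf.mul hg) h1

theorem IsLead.op (ω : Ω) {u : Fin (ar ω) → OmegaWord ar X}
    {f : Fin (ar ω) → FreeAssocOmega k ar X} (hf : ∀ i, IsLead (u i) (f i)) :
    IsLead (.of (.op ω u)) (omegaOp k ar (FreeAssocOmega k ar X) ω f) := by
  classical
  -- Expand `ω(u + (f - u))`: every term but `ω(u)` has an argument from a span of lower words.
  have hfu : f = (fun i => word k (u i)) + fun i => f i - word k (u i) := by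
    funext i
    simp
  rw [IsLead, hfu, MultilinearMap.map_add_univ, ← Finset.add_sum_erase _ _ (Finset.mem_univ
    Finset.univ), Finset.piecewise_univ, op_word, add_sub_cancel_left]
  refine sum_mem fun s hs => MultilinearMap.map_mem_of_mem_span _ _
    (fun i => word k '' if i ∈ s then {u i} else {v | Below v (u i)}) (fun y hy => ?_) _
    (fun i => ?_)
  · choose r hr hry using hy
    obtain rfl : (fun i => word k (r i)) = y := funext hry
    rw [op_word]
    refine word_mem_lowerSpan (below_op ω ?_ fun i => ?_)
    · rintro rfl
      refine (Finset.mem_erase.1 hs).1 (Finset.eq_univ_of_forall fun i => by_contra fun hi => ?_)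
      have := hr i
      rw [if_neg hi] at this
      exact Std.Irrefl.irrefl (r := Below) _ this
    · have := hr i
      split_ifs at this
      · exact .inl this
      · exact .inr this
  · by_cases hi : i ∈ s
    · rw [Finset.piecewise_eq_of_mem _ _ _ hi, if_pos hi]
      exact Submodule.subset_span ⟨u i, rfl, rfl⟩
    · rw [Finset.piecewise_eq_of_notMem _ _ _ hi, if_neg hi]
      exact hf i

theorem IsLead.repr_eq_zero {u v : OmegaWord ar X} {f : FreeAssocOmega k ar X} (hf : IsLead u f)
    (hvu : v ≠ u) (h : ¬ Below v u) : (basisWord k ar X).repr f v = 0 := by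
  have h1 := (Module.Basis.mem_span_image (basisWord k ar X)).1 hf
  have h2 : (basisWord k ar X).repr (f - word k u) v = 0 :=
    Finsupp.notMem_support_iff.1 fun hv => h (h1 hv)
  rwa [map_sub, ← basisWord_apply, Module.Basis.repr_self, Finsupp.sub_apply,
    Finsupp.single_eq_of_ne hvu, sub_zero] at h2

theorem IsLead.repr_self {u : OmegaWord ar X} {f : FreeAssocOmega k ar X} (hf : IsLead u f) :
    (basisWord k ar X).repr f u = 1 := by
  have h1 := (Module.Basis.mem_span_image (basisWord k ar X)).1 hf
  have h2 : (basisWord k ar X).repr (f - word k u) u = 0 :=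
    Finsupp.notMem_support_iff.1 fun hu => Std.Irrefl.irrefl (r := Below) _ (h1 hu)
  rwa [map_sub, ← basisWord_apply, Module.Basis.repr_self, Finsupp.sub_apply,
    Finsupp.single_eq_same, sub_eq_zero] at h2

/-- Elements with distinct leading words are linearly independent. -/
theorem linearIndependent_of_isLead {ι : Type*} {φ : ι → OmegaWord ar X}
    (hφ : Function.Injective φ) {f : ι → FreeAssocOmega k ar X} (hf : ∀ i, IsLead (φ i) (f i)) :
    LinearIndependent k f := by
  rw [linearIndependent_iff]
  intro c hc
  by_contra hc0
  obtain ⟨i₀, hi₀⟩ := Finsupp.support_nonempty_iff.2 hc0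
  -- A word that is maximal among the leading words of the terms occurs in only one of them.
  obtain ⟨⟨_, i, hi, rfl⟩, -, hmax⟩ := WellFounded.has_min
    (((c.support.finite_toSet.image φ).wellFoundedOn (r := Function.swap Below)))
    Set.univ ⟨⟨φ i₀, i₀, hi₀, rfl⟩, trivial⟩
  have h := congrArg (fun x => (basisWord k ar X).repr x (φ i)) hc
  simp only [Finsupp.linearCombination_apply, Finsupp.sum, map_sum, map_smul,
    Finsupp.finsetSum_apply, Finsupp.smul_apply, smul_eq_mul, map_zero, Finsupp.zero_apply] at h
  rw [Finset.sum_eq_single_of_mem i hi, (hf i).repr_self, mul_one] at h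
  · exact Finsupp.mem_support_iff.1 hi h
  · intro j hj hji
    rw [(hf j).repr_eq_zero (hφ.ne hji.symm) (hmax ⟨φ j, j, hj, rfl⟩ trivial), mul_zero]

variable (k) in
/-- The leading word of the value of a Lyndon–Shirshov `Ω`-word is the underlying associative word:
`v w > w v` for a Lyndon–Shirshov word `v w`, so the leading word of `[v, w]` is `v w`. -/
theorem isLead_eval_of_mem_NLSW {Y : Set (NAOmegaPrime ar X)}
    (hY : ∀ p ∈ Y, IsLead (.of p.forget) (NAOmegaPrime.eval k (letter k ar) p))
    {t : NAOmegaWord ar X} (ht : t ∈ NLSW NAOmegaPrime.DlLT Y) :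
    IsLead (NAOmegaWord.forget t) (NAOmegaWord.eval k (letter k ar) t) := by
  induction t using FreeMagma.rec with
  | of p =>
    rw [NAOmegaWord.forget_of, NAOmegaWord.eval]
    exact hY p (ht.1 p (List.mem_singleton_self p))
  | mul v w ihv ihw =>
    obtain ⟨hvw, hv, hw, -⟩ := mem_NLSW_mul.1 ht
    rw [NAOmegaWord.forget_mul, NAOmegaWord.eval]
    refine (ihv hv).lie (ihw hw) ⟨?_, ?_, ?_⟩
    · rw [deg_mul, deg_mul, add_comm]
    · rw [FreeSemigroup.length_mul, FreeSemigroup.length_mul, add_comm]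
    · simp only [letters_mul, NAOmegaWord.letters_forget, ← List.map_append]
      exact (hvw _ _ (treeLetters_ne_nil v) (treeLetters_ne_nil w) rfl).map
        (g := NAOmegaPrime.forget) fun _ _ h => h

variable (k) in
theorem isLead_eval {t : NAOmegaWord ar X} (ht : t ∈ omegaNLSW ar X) :
    IsLead (NAOmegaWord.forget t) (NAOmegaWord.eval k (letter k ar) t) := by
  have isLead_letter (x : X) : IsLead (.of (NAOmegaPrime.letter x : NAOmegaPrime ar X).forget)
      (NAOmegaPrime.eval k (letter k ar) (.letter x : NAOmegaPrime ar X)) := by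
    rw [NAOmegaPrime.forget, NAOmegaPrime.eval]
    exact isLead_word _
  obtain ⟨n, hn⟩ := Set.mem_iUnion.1 ht
  clear ht
  induction n generalizing t with
  | zero =>
    refine isLead_eval_of_mem_NLSW k ?_ hn
    rintro _ ⟨x, rfl⟩
    exact isLead_letter x
  | succ n ih =>
    refine isLead_eval_of_mem_NLSW k ?_ hn
    rintro _ (⟨x, rfl⟩ | ⟨ω, t, ht, rfl⟩)
    · exact isLead_letter x
    · rw [NAOmegaPrime.forget, NAOmegaPrime.eval]
      exact IsLead.op ω fun i => ih (ht i)

end Lead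

/-! ### The basis and the universal property -/

section Eval

variable {k : Type*} {Ω X : Type*} {ar : Ω → ℕ} [CommRing k] {A : Type*} [LieRing A]
  [LieAlgebra k A] [OmegaOperators k ar A] (σ : X → A)

theorem NAOmegaWord.eval_eq_lieEval (t : NAOmegaWord ar X) :
    NAOmegaWord.eval k σ t = lieEval (NAOmegaPrime.eval k σ) t := by
  induction t using FreeMagma.rec with
  | of p => rw [NAOmegaWord.eval, lieEval]
  | mul t s iht ihs => rw [NAOmegaWord.eval, lieEval, iht, ihs]

theorem LieHom.map_lieEval {B : Type*} [LieRing B] [LieAlgebra k B] {α : Type*} (φ : A →ₗ⁅k⁆ B)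
    (f : α → A) (t : FreeMagma α) : φ (lieEval f t) = lieEval (φ ∘ f) t := by
  induction t using FreeMagma.rec with
  | of a => rfl
  | mul t s iht ihs => rw [lieEval, LieHom.map_lie, iht, ihs, lieEval]

theorem IsLieOmegaHom.map_eval {B : Type*} [LieRing B] [LieAlgebra k B] [OmegaOperators k ar B]
    {φ : A →ₗ⁅k⁆ B} (hφ : IsLieOmegaHom k ar φ) (t : NAOmegaWord ar X) :
    φ (NAOmegaWord.eval k σ t) = NAOmegaWord.eval k (φ ∘ σ) t :=
  NAOmegaWord.eval.induct
    (motive_1 := fun p => φ (NAOmegaPrime.eval k σ p) = NAOmegaPrime.eval k (φ ∘ σ) p)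
    (motive_2 := fun t => φ (NAOmegaWord.eval k σ t) = NAOmegaWord.eval k (φ ∘ σ) t)
    (fun x => by rw [NAOmegaPrime.eval, NAOmegaPrime.eval, Function.comp_apply])
    (fun ω t ih => by
      rw [NAOmegaPrime.eval, NAOmegaPrime.eval, hφ]
      exact congrArg _ (funext ih))
    (fun p ih => by rw [NAOmegaWord.eval, NAOmegaWord.eval, ih])
    (fun t s iht ihs => by rw [NAOmegaWord.eval, NAOmegaWord.eval, LieHom.map_lie, iht, ihs]) t

variable [LinearOrder X] [LinearOrder Ω]

/-- The Lie subalgebra spanned by the values of the elements of `NLSW(Ω; X)`. -/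
def lyndonSpan (har : ∀ ω, 1 ≤ ar ω) : LieSubalgebra k A where
  toSubmodule := Submodule.span k (NAOmegaWord.eval k σ '' omegaNLSW ar X)
  lie_mem' {x y} hx hy := by
    refine LinearMap.BilinMap.apply_apply_mem_of_mem_span
      (Submodule.span k (NAOmegaWord.eval k σ '' omegaNLSW ar X)) _ _
      (LieModule.toEnd k A A : A →ₗ[k] A →ₗ[k] A) ?_ x y hx hy
    rintro _ ⟨t, ht, rfl⟩ _ ⟨s, hs, rfl⟩
    have heval : (NAOmegaWord.eval k σ : NAOmegaWord ar X → A) =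
      lieEval (NAOmegaPrime.eval k σ) := funext (NAOmegaWord.eval_eq_lieEval σ)
    rw [omegaNLSW_eq] at ht hs
    rw [heval, omegaNLSW_eq]
    exact lie_mem_span_NLSW _ k (fun p hp q hq => NAOmegaPrime.dlLT_trichotomous har hp hq) ht hs

theorem eval_mem_lyndonSpan (har : ∀ ω, 1 ≤ ar ω) {t : NAOmegaWord ar X}
    (ht : t ∈ omegaNLSW ar X) : NAOmegaWord.eval k σ t ∈ lyndonSpan (k := k) σ har :=
  Submodule.subset_span ⟨t, ht, rfl⟩

theorem lieOmegaSpan_le_lyndonSpan (har : ∀ ω, 1 ≤ ar ω) :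
    lieOmegaSpan k ar (Set.range σ) ≤ lyndonSpan σ har := by
  intro a ha
  refine mem_lieOmegaSpan.1 ha _ ?_ fun ω b hb => ?_
  · rintro _ ⟨x, rfl⟩
    have h := eval_mem_lyndonSpan (k := k) σ har (letter_mem_omegaNLSW x)
    rwa [NAOmegaWord.eval, NAOmegaPrime.eval] at h
  · refine MultilinearMap.map_mem_of_mem_span _ (lyndonSpan σ har).toSubmodule
      (fun _ => NAOmegaWord.eval k σ '' omegaNLSW ar X) (fun y hy => ?_) b hb
    choose t ht hty using hy
    obtain rfl : (fun i => NAOmegaWord.eval k σ (t i)) = y := funext hty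
    have h := eval_mem_lyndonSpan (k := k) σ har (op_mem_omegaNLSW ht)
    rwa [NAOmegaWord.eval, NAOmegaPrime.eval] at h

end Eval

section Basis

variable {k : Type*} {Ω X : Type*} {ar : Ω → ℕ} [CommRing k]

theorem LieOmega.coe_eval (t : NAOmegaWord ar X) :
    (NAOmegaWord.eval k (LieOmega.of k ar) t : LieOmega k ar X) =
      NAOmegaWord.eval k (FreeAssocOmega.letter k ar) t :=
  IsLieOmegaHom.map_eval (φ := (LieOmega k ar X).incl) _ (fun _ _ => rfl) t

theorem LieOmega.of_injective [Nontrivial k] :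
    Function.Injective (LieOmega.of k ar : X → LieOmega k ar X) := by
  intro x y h
  have h1 := (FreeAssocOmega.basisWord k ar X).injective (congrArg Subtype.val h)
  simpa using congrArg letters h1

variable [LinearOrder X] [LinearOrder Ω]

theorem LieOmega.linearIndependent_eval :
    LinearIndependent k fun t : omegaNLSW ar X =>
      (NAOmegaWord.eval k (LieOmega.of k ar) t.1 : LieOmega k ar X) := by
  refine LinearIndependent.of_comp (LieOmega k ar X).toSubmodule.subtype ?_
  refine linearIndependent_of_isLead (φ := fun t : omegaNLSW ar X => NAOmegaWord.forget t)
    (fun t s h => Subtype.ext (forget_injOn_omegaNLSW t.2 s.2 h)) fun t => ?_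
  have h := isLead_eval k t.2
  rwa [← LieOmega.coe_eval] at h

theorem LieOmega.span_eval (har : ∀ ω, 1 ≤ ar ω) :
    Submodule.span k (NAOmegaWord.eval k (LieOmega.of k ar : X → LieOmega k ar X) ''
      omegaNLSW ar X) = ⊤ := by
  refine Submodule.map_injective_of_injective (LieOmega k ar X).toSubmodule.injective_subtype ?_
  rw [Submodule.map_span, ← Set.image_comp, Submodule.map_subtype_top]
  have heval : ((LieOmega k ar X).toSubmodule.subtype ∘
      (NAOmegaWord.eval k (LieOmega.of k ar) : NAOmegaWord ar X → LieOmega k ar X)) =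
      NAOmegaWord.eval k (FreeAssocOmega.letter k ar) :=
    funext LieOmega.coe_eval
  apply le_antisymm
  · rw [Submodule.span_le]
    rintro _ ⟨t, -, rfl⟩
    exact (NAOmegaWord.eval k (LieOmega.of k ar) t : LieOmega k ar X).2
  · rw [heval]
    exact lieOmegaSpan_le_lyndonSpan _ har

variable (k X) in
/-- The basis of `Lie(Ω; X)` of the values of the Lyndon–Shirshov `Ω`-words. -/
noncomputable def LieOmega.lyndonBasis (har : ∀ ω, 1 ≤ ar ω) :
    Module.Basis (omegaNLSW ar X) k (LieOmega k ar X) :=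
  .mk LieOmega.linearIndependent_eval (by rw [← LieOmega.span_eval har, Set.image_eq_range])

theorem LieOmega.lyndonBasis_apply (har : ∀ ω, 1 ≤ ar ω) (t : omegaNLSW ar X) :
    LieOmega.lyndonBasis k X har t = NAOmegaWord.eval k (LieOmega.of k ar) (t : NAOmegaWord ar X) :=
  Module.Basis.mk_apply ..

variable {A : Type*} [LieRing A] [LieAlgebra k A] [OmegaOperators k ar A] (σ : X → A)

/-- The linear map sending the value of a Lyndon–Shirshov `Ω`-word in `Lie(Ω; X)` to its value in
`A` is compatible with brackets, because brackets are rewritten in the same way in both algebras,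
namely as in the free Lie algebra on the set of all bracketed primes. -/
theorem LieOmega.constr_lie (har : ∀ ω, 1 ≤ ar ω) (x y : LieOmega k ar X) :
    (LieOmega.lyndonBasis k X har).constr k (fun t => NAOmegaWord.eval k σ t.1) ⁅x, y⁆ =
      ⁅(LieOmega.lyndonBasis k X har).constr k (fun t => NAOmegaWord.eval k σ t.1) x,
        (LieOmega.lyndonBasis k X har).constr k (fun t => NAOmegaWord.eval k σ t.1) y⁆ := by
  set f := (LieOmega.lyndonBasis k X har).constr k (fun t => NAOmegaWord.eval k σ t.1)
  let φ := FreeLieAlgebra.lift k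
    (NAOmegaPrime.eval k (LieOmega.of k ar) : NAOmegaPrime ar X → LieOmega k ar X)
  let ψ := FreeLieAlgebra.lift k (NAOmegaPrime.eval k σ : NAOmegaPrime ar X → A)
  let g := FreeLieAlgebra.of k (X := NAOmegaPrime ar X)
  have hφ (t : NAOmegaWord ar X) : φ (lieEval g t) = NAOmegaWord.eval k (LieOmega.of k ar) t := by
    rw [LieHom.map_lieEval, NAOmegaWord.eval_eq_lieEval, FreeLieAlgebra.of_comp_lift]
  have hψ (t : NAOmegaWord ar X) : ψ (lieEval g t) = NAOmegaWord.eval k σ t := by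
    rw [LieHom.map_lieEval, NAOmegaWord.eval_eq_lieEval, FreeLieAlgebra.of_comp_lift]
  have hf (t : omegaNLSW ar X) :
      f (NAOmegaWord.eval k (LieOmega.of k ar) t.1) = NAOmegaWord.eval k σ t.1 := by
    rw [← LieOmega.lyndonBasis_apply har, Module.Basis.constr_basis]
  let B := Submodule.span k (lieEval g '' omegaNLSW ar X)
  have hfB (z : FreeLieAlgebra k (NAOmegaPrime ar X)) (hz : z ∈ B) : f (φ z) = ψ z := by
    induction hz using Submodule.span_induction with
    | mem z hz =>
      obtain ⟨t, ht, rfl⟩ := hz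
      rw [hφ, hψ, hf ⟨t, ht⟩]
    | zero => rw [map_zero, map_zero, map_zero]
    | add z w _ _ hz hw => rw [map_add, map_add, map_add, hz, hw]
    | smul c z _ hz => rw [map_smul, map_smul, map_smul, hz]
  have hB (z w : FreeLieAlgebra k (NAOmegaPrime ar X)) (hz : z ∈ B) (hw : w ∈ B) : ⁅z, w⁆ ∈ B := by
    refine LinearMap.BilinMap.apply_apply_mem_of_mem_span B _ _
      (LieModule.toEnd k (FreeLieAlgebra k (NAOmegaPrime ar X))
        (FreeLieAlgebra k (NAOmegaPrime ar X)) : _ →ₗ[k] _) ?_ z w hz hw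
    rintro _ ⟨t, ht, rfl⟩ _ ⟨s, hs, rfl⟩
    change _ ∈ Submodule.span k (lieEval g '' omegaNLSW ar X)
    rw [omegaNLSW_eq] at ht hs ⊢
    exact lie_mem_span_NLSW _ k (fun p hp q hq => NAOmegaPrime.dlLT_trichotomous har hp hq) ht hs
  have hsurj (x : LieOmega k ar X) : ∃ z ∈ B, φ z = x := by
    have h : B.map (φ : _ →ₗ[k] LieOmega k ar X) = ⊤ := by
      rw [Submodule.map_span, ← Set.image_comp, ← LieOmega.span_eval har]
      exact congrArg _ (Set.image_congr fun t _ => hφ t)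
    exact h.ge (Submodule.mem_top (x := x))
  obtain ⟨z, hz, rfl⟩ := hsurj x
  obtain ⟨w, hw, rfl⟩ := hsurj y
  rw [← LieHom.map_lie, hfB _ (hB z w hz hw), hfB z hz, hfB w hw, LieHom.map_lie]

/-- The Lie algebra homomorphism from `Lie(Ω; X)` to a Lie `Ω`-algebra `A` which extends
`σ : X → A`, given by the values of the Lyndon–Shirshov `Ω`-words in `A`. -/
noncomputable def LieOmega.lift (har : ∀ ω, 1 ≤ ar ω) : LieOmega k ar X →ₗ⁅k⁆ A where
  toLinearMap := (LieOmega.lyndonBasis k X har).constr k (fun t => NAOmegaWord.eval k σ t.1)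
  map_lie' := LieOmega.constr_lie σ har _ _

theorem LieOmega.lift_eval (har : ∀ ω, 1 ≤ ar ω) {t : NAOmegaWord ar X} (ht : t ∈ omegaNLSW ar X) :
    LieOmega.lift σ har (NAOmegaWord.eval k (LieOmega.of k ar) t) = NAOmegaWord.eval k σ t := by
  rw [← LieOmega.lyndonBasis_apply har ⟨t, ht⟩]
  exact Module.Basis.constr_basis _ k _ _

theorem LieOmega.lift_of (har : ∀ ω, 1 ≤ ar ω) (x : X) :
    LieOmega.lift σ har (LieOmega.of k ar x) = σ x := by
  have h := LieOmega.lift_eval (k := k) σ har (letter_mem_omegaNLSW x)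
  simpa only [NAOmegaWord.eval, NAOmegaPrime.eval] using h

theorem LieOmega.isLieOmegaHom_lift (har : ∀ ω, 1 ≤ ar ω) :
    IsLieOmegaHom k ar (LieOmega.lift (k := k) σ har) := by
  intro ω
  let b := LieOmega.lyndonBasis k X har
  let F : LieOmega k ar X →ₗ[k] A := LieOmega.lift (k := k) σ har
  have h : F.compMultilinearMap (omegaOp k ar (LieOmega k ar X) ω) =
      (omegaOp k ar A ω).compLinearMap fun _ => F := by
    refine Module.Basis.ext_multilinear (fun _ => b) fun t => ?_
    have h := LieOmega.lift_eval (k := k) σ har (op_mem_omegaNLSW fun i => (t i).2)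
    rw [NAOmegaWord.eval, NAOmegaPrime.eval, NAOmegaWord.eval, NAOmegaPrime.eval] at h
    simp only [b, LieOmega.lyndonBasis_apply, LinearMap.compMultilinearMap_apply,
      MultilinearMap.compLinearMap_apply]
    exact h.trans (congrArg _ (funext fun i => (LieOmega.lift_eval σ har (t i).2).symm))
  exact fun a => congrArg (fun m => m a) h

theorem LieOmega.hom_ext (har : ∀ ω, 1 ≤ ar ω) {f g : LieOmega k ar X →ₗ⁅k⁆ A}
    (hf : IsLieOmegaHom k ar f) (hg : IsLieOmegaHom k ar g)
    (h : ∀ x, f (LieOmega.of k ar x) = g (LieOmega.of k ar x)) : f = g := by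
  have h1 : (f : LieOmega k ar X →ₗ[k] A) = g := (LieOmega.lyndonBasis k X har).ext fun t => by
    rw [LieOmega.lyndonBasis_apply]
    refine (hf.map_eval _ t.1).trans (.trans ?_ (hg.map_eval _ t.1).symm)
    rw [show f ∘ LieOmega.of k ar = g ∘ LieOmega.of k ar from funext h]
  exact LieHom.ext fun x => LinearMap.congr_fun h1 x

end Basis

theorem mainTheorem1 {k : Type*} [Field k]
    {Ω : Type*} [LinearOrder Ω] [WellFoundedLT Ω] (ar : Ω → ℕ) (har : ∀ ω, 1 ≤ ar ω)
    (X : Type*) [LinearOrder X] [WellFoundedLT X] :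
    IsFreeLieOmegaAlgebra.{w} k ar (LieOmega.of k ar : X → LieOmega k ar X) ∧
      ∃ b : Module.Basis (omegaNLSW ar X) k (LieOmega k ar X),
        ∀ t : omegaNLSW ar X,
          b t = NAOmegaWord.eval k (LieOmega.of k ar) (t : NAOmegaWord ar X) := by
  refine ⟨⟨LieOmega.of_injective, fun A _ _ _ σ => ⟨LieOmega.lift σ har,
    ⟨LieOmega.isLieOmegaHom_lift σ har, LieOmega.lift_of σ har⟩, ?_⟩⟩,
    LieOmega.lyndonBasis k X har, LieOmega.lyndonBasis_apply har⟩
  rintro g ⟨hg, hgσ⟩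
  exact LieOmega.hom_ext har hg (LieOmega.isLieOmegaHom_lift σ har) fun x => by
    rw [hgσ, LieOmega.lift_of]
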